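/- Let $n\ge 1$, $k\ge 2$ be integers and let $q\in\mathbb C^\times$ be such that either $q$ is not a root of unity, or $k<\ell$, where $\ell$ is the smallest positive integer with $q^{2\ell}=1$. Put $\beta=q+q^{-1}$ and $[m]=(q^m-q^{-m})/(q-q^{-1})$. For $N=n+k$ let $\mathsf{TL}_N=\mathsf{TL}_N(\beta)$ be the Temperley-Lieb algebra, spanned by the $(N,N)$-diagrams (non-crossing pairings of $N$ points on the left and $N$ points on the right side of a rectangle) and multiplied by concatenation, each closed loop being replaced by a factor $\beta$. Let $E_i$ ($1\le i<N$) be its standard generators, and let $P_1=1$ and $P_j=P_{j-1}-\frac{[j-1]}{[j]}P_{j-1}E_{N-j+1}P_{j-1}$ for $2\le j\le k$ (the Wenzl-Jones projectors). Then $P_k$ is an idempotent, and $\mathsf b_{n,k}=P_k\mathsf{TL}_{N}P_k$, with identity $P_k$, is the boundary seam algebra. For a $\mathsf{TL}_N$-module $V$ let $\mathrm{res}_{P_k}V=P_kV$, a $\mathsf b_{n,k}$-module. For $0\le d\le N$ with $d\equiv N$ mod $2$, the cellular module $\mathsf S_N^d$ is the span of the monic $(N,d)$-diagrams (those with $d$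 links crossing from left to right), on which $\mathsf{TL}_N$ acts by concatenation, non-monic results being set to zero. It carries the bilinear form for which $\langle v,w\rangle_N^d$, for monic diagrams $v,w$ and $v^*$ the left-right reflection of $v$, is $\beta^p$ if $v^*w$ is $\beta^p$ times the identity $(d,d)$-diagram, and $0$ if $v^*w$ is not monic. Let $\mathsf R_N^d$ be its radical. The cellular $\mathsf b_{n,k}$-module $\mathsf S_{n,k}^d=\mathrm{res}_{P_k}\mathsf S_N^d$ is the span of the elements $P_kw$, $w$ a monic $(N,d)$-diagram; its bilinear form is $\langle P_kv,P_kw\rangle_{n,k}^d=\langle P_kv,P_kw\rangle_N^d$, and $\mathsf R_{n,k}^d$ is the radical of that form. Let $\Delta_{n,k}=\{d\in\mathbb N: d\le n+k,\ d\equiv n+k \bmod 2,\ n+d\ge k\}$, and let $\Delta^0_{n,k}$ be the set of those $d\in\Delta_{n,k}$ for which $\langle\cdot,\cdot\rangle_{n,k}^d$ is not identically zero. Then: (a) for all $d\in\Delta_{n,k}$, there is an isomorphism of $\mathsf b_{n,k}$-modules $\mathsf R_{n,k}^d\simeq \mathrm{res}_{P_k}(\mathsf R_{n+k}^d)$, compatible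 with the inclusions of both modules in $\mathsf S_{n+k}^d$; (b) for all $d\in\Delta^0_{n,k}$, with $\mathrm{rad}\,\mathsf M$ the Jacobson radical (the intersection of the maximal submodules) of a module $\mathsf M$, there is an isomorphism of $\mathsf b_{n,k}$-modules $\mathrm{rad}(\mathrm{res}_{P_k}\mathsf S_{n+k}^d)\simeq\mathrm{res}_{P_k}(\mathrm{rad}\,\mathsf S_{n+k}^d)$, compatible with the inclusions of both modules in $\mathsf S_{n+k}^d$. -/

import Mathlib

namespace TemperleyLieb

/-- The `n` points on the left side and the `m` points on the right side of a rectangle, numbered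
from top to bottom on each side, listed in the order in which they are met when walking once around
the boundary: down the left side, then up the right side. -/
def pos (n m : ℕ) : Fin n ⊕ Fin m ≃ Fin (n + m) :=
  (Equiv.sumCongr (Equiv.refl _) Fin.revPerm).trans finSumFinEquiv

/-- An `(n, m)`-diagram: `n` points on the left (`Sum.inl`) and `m` points on the right (`Sum.inr`)
of a rectangle, connected pairwise by links (`link s` is the point linked to `s`), such that no two
links cross. -/
@[ext]
structure Diagram (n m : ℕ) where
  link : Fin n ⊕ Fin m → Fin n ⊕ Fin m
  link_link : ∀ s, link (link s) = s
  link_ne : ∀ s, link s ≠ s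
  planar : ∀ s t, ¬ (pos n m s < pos n m t ∧ pos n m t < pos n m (link s) ∧
    pos n m (link s) < pos n m (link t))

/-! ### Two involutions on a finite set, and products of labels around a diagram

These facts show below that stacking two diagrams gives again a diagram. -/

theorem existsUnique_end {W : Type*} [Finite W] (α β : Equiv.Perm W) (hα : ∀ w, α (α w) = w)
    (hβ : ∀ w, β (β w) = w) (hαβ : ∀ w, α w = w → β w ≠ w) (x : W) (hx : β x = x) :
    (∃! y, y ≠ x ∧ (∃ i : ℤ, ((α * β) ^ i) x = y) ∧ (α y = y ∨ β y = y)) ∧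
      ∀ y, (∃ i : ℤ, ((α * β) ^ i) x = y) →
        (∃ i : ℤ, ((α * β) ^ i) x = α y) ∧ (∃ i : ℤ, ((α * β) ^ i) x = β y) := by
  set τ := α * β with hτ
  have hα' : α⁻¹ = α := by ext w; rw [Equiv.Perm.inv_eq_iff_eq, hα]
  have hβ' : β⁻¹ = β := by ext w; rw [Equiv.Perm.inv_eq_iff_eq, hβ]
  have hbt : ∀ i : ℤ, β ((τ ^ i) x) = (τ ^ (-i)) x := by
    intro i
    have h1 : β * τ * β⁻¹ = τ⁻¹ := by rw [hτ, mul_inv_rev, hα', hβ']; ext w; simp [hβ]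
    have h2 : β * τ ^ i * β⁻¹ = τ ^ (-i) := by rw [← conj_zpow, h1, inv_zpow, zpow_neg]
    rw [← h2]; simp [hβ', hx]
  have hat : ∀ i : ℤ, α ((τ ^ i) x) = (τ ^ (1 - i)) x := by
    intro i
    have : α = τ * β := by rw [hτ, mul_assoc]; ext w; simp [hβ]
    rw [this, Equiv.Perm.mul_apply, hbt, sub_eq_add_neg, zpow_add, zpow_one]
    rfl
  set N : ℤ := (Function.minimalPeriod (τ • ·) x : ℤ) with hN
  have hdvd : ∀ i : ℤ, (τ ^ i) x = x ↔ N ∣ i := fun i =>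
    MulAction.zpow_smul_eq_iff_minimalPeriod_dvd (a := τ) (b := x)
  have heq : ∀ i j : ℤ, (τ ^ i) x = (τ ^ j) x ↔ N ∣ i - j := by
    intro i j
    rw [← hdvd, sub_eq_neg_add, zpow_add, Equiv.Perm.mul_apply, zpow_neg, Equiv.Perm.inv_eq_iff_eq]
  have hNpos : 0 < N := by
    rw [hN]
    exact_mod_cast Function.minimalPeriod_pos_of_mem_periodicPts
      (Function.Injective.mem_periodicPts (MulAction.injective τ) x)
  have hfixb : ∀ i : ℤ, β ((τ ^ i) x) = (τ ^ i) x ↔ N ∣ 2 * i := by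
    intro i; rw [eq_comm, hbt, heq]; ring_nf
  have hfixa : ∀ i : ℤ, α ((τ ^ i) x) = (τ ^ i) x ↔ N ∣ 2 * i - 1 := by
    intro i; rw [eq_comm, hat, heq]; ring_nf
  refine ⟨existsUnique_of_exists_of_unique ?_ ?_, by
    rintro y ⟨i, rfl⟩
    exact ⟨⟨1 - i, (hat i).symm⟩, ⟨-i, (hbt i).symm⟩⟩⟩
  · rcases Int.even_or_odd' N with ⟨m, hm | hm⟩
    · refine ⟨(τ ^ m) x, ?_, ⟨m, rfl⟩, Or.inr ((hfixb m).2 ⟨1, by omega⟩)⟩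
      rw [Ne, hdvd]
      intro h
      have := Int.le_of_dvd (by omega) h
      omega
    · refine ⟨(τ ^ (m + 1)) x, ?_, ⟨m + 1, rfl⟩, Or.inl ((hfixa (m + 1)).2 ⟨1, by omega⟩)⟩
      rw [Ne, hdvd]
      intro h
      have h1 := Int.le_of_dvd (by omega) h
      have hm0 : m = 0 := by omega
      have h0 := (hfixa 0).2 ⟨-1, by rw [hm, hm0]; norm_num⟩
      exact hαβ x (by simpa using h0) hx
  · rintro y z ⟨hy, ⟨i, rfl⟩, hi⟩ ⟨hz, ⟨j, rfl⟩, hj⟩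
    rw [Ne, hdvd] at hy hz
    rw [hfixa, hfixb] at hi hj
    rw [heq]
    have aux : ∀ i : ℤ, ¬ N ∣ i → (N ∣ 2 * i - 1 ∨ N ∣ 2 * i) →
        (∃ c, 2 * i - 1 = N * c) ∨ (∃ m c, N = 2 * m ∧ i = m * (2 * c + 1)) := by
      rintro i hi (⟨c, hc⟩ | ⟨c, hc⟩)
      · exact Or.inl ⟨c, hc⟩
      · right
        rcases Int.even_or_odd' c with ⟨c', h' | h'⟩
        · exfalso; apply hi; refine ⟨c', ?_⟩
          have : 2 * i = 2 * (N * c') := by rw [hc, h']; ring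
          omega
        · rcases Int.even_or_odd' N with ⟨m, hm | hm⟩
          · refine ⟨m, c', hm, ?_⟩
            have : 2 * i = 2 * (m * (2 * c' + 1)) := by rw [hc, h', hm]; ring
            omega
          · exfalso
            have : 2 * i = 2 * (2 * m * c' + m + c') + 1 := by rw [hc, h', hm]; ring
            omega
    rcases aux i hy hi with ⟨c, hc⟩ | ⟨m, c, hm, hc⟩ <;>
      rcases aux j hz hj with ⟨c', hc'⟩ | ⟨m', c', hm', hc'⟩
    · rcases Int.even_or_odd' N with ⟨m, hm | hm⟩
      · exfalso
        have : 2 * i - 1 = 2 * (m * c) := by rw [hc, hm]; ring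
        omega
      · have h2 : N ∣ 2 * (i - j) := ⟨c - c', by rw [mul_sub N, ← hc, ← hc']; ring⟩
        exact Int.dvd_of_dvd_mul_right_of_gcd_one h2 (by rw [hm]; simp [Int.gcd_comm])
    · exfalso
      have : 2 * i - 1 = 2 * (m' * c) := by rw [hc, hm']; ring
      omega
    · exfalso
      have : 2 * j - 1 = 2 * (m * c') := by rw [hc', hm]; ring
      omega
    · have : m' = m := by omega
      subst this
      exact ⟨c - c', by rw [hc, hc', hm]; ring⟩

theorem existsUnique_end' {W : Type*} [Finite W] (α β : Equiv.Perm W) (hα : ∀ w, α (α w) = w)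
    (hβ : ∀ w, β (β w) = w) (hαβ : ∀ w, α w = w → β w ≠ w) (r : Setoid W)
    (hrα : ∀ w, r w (α w)) (hrβ : ∀ w, r w (β w))
    (hr : ∀ S : W → Prop, (∀ w, S w → S (α w)) → (∀ w, S w → S (β w)) →
      ∀ x y, r x y → S x → S y) (x : W) (hx : β x = x) :
    ∃! y, y ≠ x ∧ r x y ∧ (α y = y ∨ β y = y) := by
  obtain ⟨h1, h2⟩ := existsUnique_end α β hα hβ hαβ x hx
  have hiff : ∀ y, r x y ↔ ∃ i : ℤ, ((α * β) ^ i) x = y := by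
    intro y
    constructor
    · intro h
      exact hr (fun y => ∃ i : ℤ, ((α * β) ^ i) x = y) (fun w hw => (h2 w hw).1)
        (fun w hw => (h2 w hw).2) x y h ⟨0, by simp⟩
    · have hsτ : ∀ w, r w ((α * β) w) := fun w => r.trans (hrβ w) (hrα _)
      rintro ⟨i, rfl⟩
      induction i using Int.induction_on with
      | zero => exact r.refl _
      | succ i ih =>
        rw [add_comm, zpow_add, zpow_one]
        exact r.trans ih (hsτ _)
      | pred i ih =>
        have h := hsτ (((α * β) ^ (-(i : ℤ) - 1)) x)
        rw [← Equiv.Perm.mul_apply, ← zpow_one_add,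
          show (1 : ℤ) + (-(i : ℤ) - 1) = -i by ring] at h
        exact r.trans ih (r.symm h)
  simpa only [hiff] using h1

theorem prod_eq_one_of_noncrossing {G : Type*} [Monoid G] (F : ℕ → G) (σ : ℕ → ℕ) (len : ℕ) :
    ∀ s : ℕ, (∀ i, s ≤ i → i < s + len → s ≤ σ i ∧ σ i < s + len ∧ σ (σ i) = i ∧ σ i ≠ i ∧
        F (σ i) = F i ∧ F i * F i = 1) →
      (∀ i j, s ≤ i → σ j < s + len → s ≤ j → j < s + len → i < j → j < σ i → σ i < s + len →
        ¬ σ i < σ j) →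
      ((List.range' s len).map F).prod = 1 := by
  induction len using Nat.strong_induction_on with
  | _ len ih =>
    intro s h hnc
    rcases Nat.eq_zero_or_pos len with rfl | hlen
    · simp
    · obtain ⟨h1, h2, h3, h4, h5, h6⟩ := h s le_rfl (by omega)
      obtain ⟨a, ha⟩ : ∃ a, σ s = s + 1 + a := ⟨σ s - s - 1, by omega⟩
      obtain ⟨b, hb⟩ : ∃ b, len = 1 + (a + (1 + b)) := ⟨len - a - 2, by omega⟩
      have key : ∀ i, s < i → i < s + len → i ≠ σ s →
          (i < σ s → s + 1 ≤ σ i ∧ σ i < σ s) ∧ (σ s < i → σ s < σ i) := by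
        intro i hi1 hi2 hi3
        obtain ⟨g1, g2, g3, g4, -, -⟩ := h i (by omega) hi2
        have n1 : σ i ≠ s := fun e => hi3 (by rw [← e, g3])
        have n2 : σ i ≠ σ s := fun e => by
          have := congrArg σ e; rw [g3, h3] at this; omega
        refine ⟨fun hlt => ⟨by omega, ?_⟩, fun hlt => ?_⟩
        · have := hnc s i le_rfl g2 (by omega) hi2 hi1 hlt h2
          omega
        · by_contra hcon
          have := hnc s (σ i) le_rfl (by rw [g3]; omega) g1 g2 (by omega) (by omega) h2
          rw [g3] at this
          omega
      have e1 : ((List.range' (s + 1) a).map F).prod = 1 := by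
        apply ih a (by omega)
        · intro i hi1 hi2
          obtain ⟨g1, g2, g3, g4, g5, g6⟩ := h i (by omega) (by omega)
          have := (key i (by omega) (by omega) (by omega)).1 (by omega)
          exact ⟨by omega, by omega, g3, g4, g5, g6⟩
        · intro i j a1 a2 a3 a4 a5 a6 a7
          exact hnc i j (by omega) (by omega) (by omega) (by omega) a5 a6 (by omega)
      have e2 : ((List.range' (s + 1 + a + 1) b).map F).prod = 1 := by
        apply ih b (by omega)
        · intro i hi1 hi2
          obtain ⟨g1, g2, g3, g4, g5, g6⟩ := h i (by omega) (by omega)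
          have := (key i (by omega) (by omega) (by omega)).2 (by omega)
          exact ⟨by omega, by omega, g3, g4, g5, g6⟩
        · intro i j a1 a2 a3 a4 a5 a6 a7
          exact hnc i j (by omega) (by omega) (by omega) (by omega) a5 a6 (by omega)
      have hl : List.range' s len = [s] ++ (List.range' (s + 1) a ++ ([s + 1 + a] ++
          List.range' (s + 1 + a + 1) b)) := by
        rw [hb, ← List.range'_append_1, ← List.range'_append_1, ← List.range'_append_1]
        rfl
      rw [hl]
      simp only [List.map_append, List.prod_append, e1, e2, List.map_cons, List.map_nil,
        List.prod_cons, List.prod_nil, mul_one, one_mul]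
      rw [← ha, h5, h6]

theorem prod_eq_of_first {G : Type*} [Monoid G] (F : ℕ → G) (s len i : ℕ) (h1 : s ≤ i)
    (h2 : i < s + len) (h : ∀ j, s ≤ j → j < i → F j = 1) :
    ((List.range' s len).map F).prod =
      F i * ((List.range' (i + 1) (s + len - (i + 1))).map F).prod := by
  have hl : List.range' s len = List.range' s (i - s) ++ ([i] ++
      List.range' (i + 1) (s + len - (i + 1))) := by
    conv_lhs => rw [show len = (i - s) + (1 + (s + len - (i + 1))) by omega]
    rw [← List.range'_append_1, ← List.range'_append_1, show s + (i - s) = i by omega]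
    rfl
  have e : ((List.range' s (i - s)).map F).prod = 1 := by
    apply List.prod_eq_one
    intro x hx
    obtain ⟨j, hj, rfl⟩ := List.mem_map.1 hx
    rw [List.mem_range'_1] at hj
    exact h j hj.1 (by omega)
  rw [hl]
  simp only [List.map_append, List.prod_append, e, one_mul, List.map_cons, List.map_nil,
    List.prod_cons, List.prod_nil, mul_one]


theorem prod_boundary {n m : ℕ} {G : Type*} [Group G] (f : Fin n ⊕ Fin m → G)
    (hf2 : ∀ s, f s * f s = 1) :
    ((List.range' 0 (n + m)).map
      (fun i => if h : i < n + m then f ((pos n m).symm ⟨i, h⟩) else 1)).prod =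
    (List.ofFn fun i => f (Sum.inl i)).prod * (List.ofFn fun j => f (Sum.inr j)).prod⁻¹ := by
  have hinv : ∀ s, (f s)⁻¹ = f s := fun s => inv_eq_of_mul_eq_one_left (hf2 s)
  have e1 : (List.range' 0 (n + m)).map
      (fun i => if h : i < n + m then f ((pos n m).symm ⟨i, h⟩) else 1) =
      List.ofFn (fun i => f ((pos n m).symm i)) := by
    apply List.ext_getElem
    · simp
    · intro i h1 h2
      simp at h1
      simp [h1]
  have e2 : List.ofFn (fun i => f ((pos n m).symm i)) = List.ofFn (fun i => f (Sum.inl i)) ++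
      (List.ofFn fun j => f (Sum.inr j)).reverse := by
    rw [List.ofFn_add]
    congr 1
    · congr 1; ext i; congr 1; rw [Equiv.symm_apply_eq]; simp [pos]; rfl
    · apply List.ext_getElem
      · simp
      · intro i h1 h2
        simp at h1
        simp only [List.getElem_ofFn, List.getElem_reverse, List.length_ofFn]
        congr 1
        rw [Equiv.symm_apply_eq]
        simp [pos]
        ext
        simp [Fin.val_rev]
        omega
  rw [e1, e2, List.prod_append, List.prod_inv_reverse]
  simp [Function.comp_def, hinv]

theorem Diagram.prod_left_eq {n m : ℕ} (a : Diagram n m) {G : Type*} [Group G]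
    (f : Fin n ⊕ Fin m → G) (hf : ∀ s, f (a.link s) = f s) (hf2 : ∀ s, f s * f s = 1) :
    (List.ofFn fun i => f (Sum.inl i)).prod = (List.ofFn fun j => f (Sum.inr j)).prod := by
  set e := pos n m with he
  set F : ℕ → G := fun i => if h : i < n + m then f (e.symm ⟨i, h⟩) else 1 with hF
  set σ : ℕ → ℕ := fun i => if h : i < n + m then (e (a.link (e.symm ⟨i, h⟩)) : ℕ) else i with hσ
  have hσv : ∀ i (h : i < n + m), σ i = (e (a.link (e.symm ⟨i, h⟩)) : ℕ) := fun i h => by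
    simp [hσ, h]
  have hFv : ∀ i (h : i < n + m), F i = f (e.symm ⟨i, h⟩) := fun i h => by
    simp [hF, h]
  have main : ((List.range' 0 (n + m)).map F).prod = 1 := by
    apply prod_eq_one_of_noncrossing F σ
    · intro i _ hi
      rw [Nat.zero_add] at hi
      refine ⟨Nat.zero_le _, ?_, ?_, ?_, ?_, ?_⟩
      · rw [hσv i hi]; omega
      · rw [hσv _ (by rw [hσv i hi]; omega)]
        simp [hσv i hi, a.link_link]
      · rw [hσv i hi]
        intro h
        have : e (a.link (e.symm ⟨i, hi⟩)) = ⟨i, hi⟩ := Fin.ext h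
        rw [← Equiv.eq_symm_apply] at this
        exact a.link_ne _ this
      · rw [hFv i hi, hFv _ (by rw [hσv i hi]; omega)]
        simp [hσv i hi, hf]
      · rw [hFv i hi, hf2]
    · intro i j _ h1 _ h3 h4 h5 h6 h7
      rw [Nat.zero_add] at *
      have hi : i < n + m := by omega
      apply a.planar (e.symm ⟨i, hi⟩) (e.symm ⟨j, h3⟩)
      rw [hσv i hi] at *
      rw [hσv j h3] at *
      refine ⟨?_, ?_, ?_⟩ <;> rw [Fin.lt_def] <;> simpa [he] using ‹_›
  rw [hF, he, prod_boundary f hf2] at main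
  exact mul_inv_eq_one.1 main

theorem planar_of_prod_eq {n m : ℕ} (l : Fin n ⊕ Fin m → Fin n ⊕ Fin m)
    (hl : ∀ s, l (l s) = s)
    (h : ∀ f : Fin n ⊕ Fin m → Equiv.Perm (Fin 3), (∀ s, f (l s) = f s) →
      (∀ s, f s * f s = 1) →
      (List.ofFn fun i => f (Sum.inl i)).prod = (List.ofFn fun j => f (Sum.inr j)).prod)
    (s t : Fin n ⊕ Fin m) : ¬ (pos n m s < pos n m t ∧ pos n m t < pos n m (l s) ∧
      pos n m (l s) < pos n m (l t)) := by
  rintro ⟨h1, h2, h3⟩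
  set e := pos n m with he
  have hts : t ≠ s := fun h => by subst h; exact lt_irrefl _ h1
  have htl : t ≠ l s := fun h => by subst h; exact lt_irrefl _ h2
  have hlt : l t ≠ s := fun h => htl (by rw [← h, hl])
  have hll : l t ≠ l s := fun h => hts (by rw [← hl t, h, hl])
  set f : Fin n ⊕ Fin m → Equiv.Perm (Fin 3) := fun r =>
    if r = s ∨ r = l s then Equiv.swap 0 1 else if r = t ∨ r = l t then Equiv.swap 1 2 else 1
    with hf
  have hfl : ∀ r, f (l r) = f r := by
    intro r
    have k : ∀ u, (l r = u ∨ l r = l u) ↔ (r = u ∨ r = l u) := by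
      intro u
      constructor
      · rintro (h | h)
        · right; rw [← h, hl]
        · left; rw [← hl r, h, hl]
      · rintro (rfl | rfl)
        · right; rfl
        · left; rw [hl]
    simp only [hf, k]
  have hf2 : ∀ r, f r * f r = 1 := by
    intro r; simp only [hf]; split_ifs <;> decide
  have hw := h f hfl hf2
  set F : ℕ → Equiv.Perm (Fin 3) :=
    fun i => if h : i < n + m then f (e.symm ⟨i, h⟩) else 1 with hF
  have hFe : ∀ r, F (e r) = f r := fun r => by simp [hF]
  have hF1 : ∀ i, i ≠ (e s : ℕ) → i ≠ (e t : ℕ) → i ≠ (e (l s) : ℕ) → i ≠ (e (l t) : ℕ) →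
      F i = 1 := by
    intro i i1 i2 i3 i4
    by_cases hi : i < n + m
    · have hr : i = (e (e.symm ⟨i, hi⟩) : ℕ) := by simp
      rw [hr, hFe]
      have : ∀ u, i ≠ (e u : ℕ) → e.symm ⟨i, hi⟩ ≠ u := by
        rintro u hu rfl; exact hu hr
      simp [hf, this _ i1, this _ i2, this _ i3, this _ i4]
    · simp [hF, hi]
  have main : ((List.range' 0 (n + m)).map F).prod = 1 := by
    rw [hF, he, prod_boundary f hf2, hw, mul_inv_cancel]
  rw [Fin.lt_def] at h1 h2 h3
  have hlast := (e (l t)).isLt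
  rw [prod_eq_of_first F 0 (n + m) (e s) (by omega) (by omega)
      (fun j _ _ => hF1 j (by omega) (by omega) (by omega) (by omega)),
    prod_eq_of_first F _ _ (e t) (by omega) (by omega)
      (fun j _ _ => hF1 j (by omega) (by omega) (by omega) (by omega)),
    prod_eq_of_first F _ _ (e (l s)) (by omega) (by omega)
      (fun j _ _ => hF1 j (by omega) (by omega) (by omega) (by omega)),
    prod_eq_of_first F _ _ (e (l t)) (by omega) (by omega)
      (fun j _ _ => hF1 j (by omega) (by omega) (by omega) (by omega)),
    List.prod_eq_one, hFe, hFe, hFe, hFe] at main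
  · have g1 : f s = Equiv.swap 0 1 := by simp [hf]
    have g2 : f t = Equiv.swap 1 2 := by simp [hf, hts, htl]
    rw [hfl, hfl, g1, g2] at main
    revert main; decide
  · intro x hx
    obtain ⟨j, hj, rfl⟩ := List.mem_map.1 hx
    rw [List.mem_range'_1] at hj
    exact hF1 j (by omega) (by omega) (by omega) (by omega)


/-! ### Composition of diagrams -/

section Composition

variable {n m p : ℕ}

/-- Put `a` on the left of `b`, identifying the right points of `a` with the left points of `b`.
`Step a b` relates any two of the `n + m + p` points which are the ends of one link. -/
inductive Step (a : Diagram n m) (b : Diagram m p) :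
    Fin n ⊕ (Fin m ⊕ Fin p) → Fin n ⊕ (Fin m ⊕ Fin p) → Prop
  | left (s : Fin n ⊕ Fin m) : Step a b (Sum.map id Sum.inl s) (Sum.map id Sum.inl (a.link s))
  | right (s : Fin m ⊕ Fin p) : Step a b (Sum.inr s) (Sum.inr (b.link s))

/-- Two points are related if they lie on the same connected curve of the concatenation. -/
def stacked (a : Diagram n m) (b : Diagram m p) : Setoid (Fin n ⊕ (Fin m ⊕ Fin p)) :=
  Relation.EqvGen.setoid (Step a b)

/-- The inclusion of the `n` leftmost and `p` rightmost points in the set of all points. -/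
def outer (n m p : ℕ) : Fin n ⊕ Fin p → Fin n ⊕ (Fin m ⊕ Fin p) := Sum.map id Sum.inr

theorem stacked_iff {a : Diagram n m} {b : Diagram m p} {T : Type*}
    {f : Fin n ⊕ (Fin m ⊕ Fin p) → T}
    (ha : ∀ s, f (Sum.map id Sum.inl (a.link s)) = f (Sum.map id Sum.inl s))
    (hb : ∀ s, f (Sum.inr (b.link s)) = f (Sum.inr s)) {x y : Fin n ⊕ (Fin m ⊕ Fin p)}
    (h : stacked a b x y) : f x = f y := by
  induction h with
  | rel x y h =>
    cases h with
    | left s => exact (ha s).symm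
    | right s => exact (hb s).symm
  | refl x => rfl
  | symm x y _ ih => exact ih.symm
  | trans x y z _ _ ih1 ih2 => exact ih1.trans ih2

theorem exists_ends (a : Diagram n m) (b : Diagram m p) (s : Fin n ⊕ Fin p) :
    ∃! t, t ≠ s ∧ stacked a b (outer n m p s) (outer n m p t) := by
  have hA : Function.Involutive (fun w : Fin n ⊕ (Fin m ⊕ Fin p) =>
      Equiv.sumAssoc _ _ _ (Sum.map a.link id ((Equiv.sumAssoc _ _ _).symm w))) := by
    intro w
    dsimp only
    rw [Equiv.symm_apply_apply, Sum.map_map]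
    have : a.link ∘ a.link = id := funext a.link_link
    simp [this]
  have hB : Function.Involutive (fun w : Fin n ⊕ (Fin m ⊕ Fin p) => Sum.map id b.link w) := by
    intro w
    dsimp only
    rw [Sum.map_map]
    have : b.link ∘ b.link = id := funext b.link_link
    simp [this]
  set α := hA.toPerm with hα
  set β := hB.toPerm with hβ
  have hαl : ∀ r, α (Sum.map id Sum.inl r) = Sum.map id Sum.inl (a.link r) := by
    intro r
    have e : ∀ r : Fin n ⊕ Fin m, (Sum.map id Sum.inl r : Fin n ⊕ (Fin m ⊕ Fin p)) =
        Equiv.sumAssoc _ _ _ (Sum.inl r) := by rintro (r | r) <;> rfl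
    change Equiv.sumAssoc _ _ _ (Sum.map a.link id ((Equiv.sumAssoc _ _ _).symm _)) = _
    rw [e, e, Equiv.symm_apply_apply]; rfl
  have hαr : ∀ z, α (Sum.inr (Sum.inr z)) = Sum.inr (Sum.inr z) := fun z => rfl
  have hβl : ∀ x, β (Sum.inl x) = Sum.inl x := fun x => rfl
  have hβr : ∀ r, β (Sum.inr r) = Sum.inr (b.link r) := fun x => rfl
  have hα2 : ∀ w, α (α w) = w := hA
  have hβ2 : ∀ w, β (β w) = w := hB
  have injL : Function.Injective (Sum.map id Sum.inl : Fin n ⊕ Fin m → Fin n ⊕ (Fin m ⊕ Fin p)) :=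
    Function.injective_id.sumMap Sum.inl_injective
  have hcase : ∀ w : Fin n ⊕ (Fin m ⊕ Fin p), (∃ r, w = Sum.map id Sum.inl r) ∨
      ∃ z, w = Sum.inr (Sum.inr z) := by
    rintro (x | y | z)
    · exact Or.inl ⟨Sum.inl x, rfl⟩
    · exact Or.inl ⟨Sum.inr y, rfl⟩
    · exact Or.inr ⟨z, rfl⟩
  have hαfix : ∀ w, α w = w ↔ ∃ z, w = Sum.inr (Sum.inr z) := by
    intro w
    constructor
    · intro h
      rcases hcase w with ⟨r, rfl⟩ | h'
      · rw [hαl] at h; exact absurd (injL h) (a.link_ne r)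
      · exact h'
    · rintro ⟨z, rfl⟩; exact hαr z
  have hβfix : ∀ w, β w = w ↔ ∃ x, w = Sum.inl x := by
    intro w
    constructor
    · intro h
      rcases w with x | r
      · exact ⟨x, rfl⟩
      · rw [hβr] at h; exact absurd (Sum.inr_injective h) (b.link_ne r)
    · rintro ⟨x, rfl⟩; exact hβl x
  have hnot : ∀ w, α w = w → β w ≠ w := by
    intro w h1 h2
    obtain ⟨z, rfl⟩ := (hαfix w).1 h1
    obtain ⟨x, hx⟩ := (hβfix _).1 h2
    exact absurd hx (by simp)
  have hends : ∀ w, (α w = w ∨ β w = w) ↔ ∃ t, w = outer n m p t := by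
    intro w
    rw [hαfix, hβfix]
    constructor
    · rintro (⟨z, rfl⟩ | ⟨x, rfl⟩)
      · exact ⟨Sum.inr z, rfl⟩
      · exact ⟨Sum.inl x, rfl⟩
    · rintro ⟨x | z, rfl⟩
      · exact Or.inr ⟨x, rfl⟩
      · exact Or.inl ⟨z, rfl⟩
  have hsα : ∀ w, stacked a b w (α w) := by
    intro w
    rcases hcase w with ⟨r, rfl⟩ | ⟨z, rfl⟩
    · rw [hαl]; exact Relation.EqvGen.rel _ _ (Step.left r)
    · rw [hαr]
  have hsβ : ∀ w, stacked a b w (β w) := by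
    rintro (x | r)
    · rw [hβl]
    · rw [hβr]; exact Relation.EqvGen.rel _ _ (Step.right r)
  have hmin : ∀ S : Fin n ⊕ (Fin m ⊕ Fin p) → Prop, (∀ w, S w → S (α w)) →
      (∀ w, S w → S (β w)) → ∀ x y, stacked a b x y → S x → S y := by
    intro S h1 h2 x y hxy
    refine (stacked_iff (f := S) (fun r => ?_) (fun r => ?_) hxy).mp
    · rw [← hαl]; exact propext ⟨fun h => by simpa only [hα2] using h1 _ h, h1 _⟩
    · rw [← hβr]; exact propext ⟨fun h => by simpa only [hβ2] using h2 _ h, h2 _⟩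
  have hinj : Function.Injective (outer n m p) := Function.injective_id.sumMap Sum.inr_injective
  have key : ∃! y, y ≠ outer n m p s ∧ stacked a b (outer n m p s) y ∧ (α y = y ∨ β y = y) := by
    rcases (hends _).2 ⟨s, rfl⟩ with h | h
    · have := existsUnique_end' β α hβ2 hα2 (fun w h1 h2 => hnot w h2 h1) (stacked a b) hsβ hsα
        (fun S h1 h2 => hmin S h2 h1) _ h
      simpa only [or_comm] using this
    · exact existsUnique_end' α β hα2 hβ2 hnot (stacked a b) hsα hsβ hmin _ h
  obtain ⟨y, ⟨h1, h2, h3⟩, h4⟩ := key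
  obtain ⟨t, rfl⟩ := (hends y).1 h3
  refine ⟨t, ⟨fun h => h1 (by rw [h]), h2⟩, ?_⟩
  rintro t' ⟨g1, g2⟩
  exact hinj (h4 _ ⟨fun h => g1 (hinj h), g2, (hends _).2 ⟨t', rfl⟩⟩)

theorem link_spec_aux {l : Fin n ⊕ Fin p → Fin n ⊕ Fin p} (a : Diagram n m) (b : Diagram m p)
    (hl : ∀ s, l s ≠ s ∧ stacked a b (outer n m p s) (outer n m p (l s))) :
    (∀ s, l (l s) = s) ∧ ∀ s t, ¬ (pos n p s < pos n p t ∧ pos n p t < pos n p (l s) ∧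
      pos n p (l s) < pos n p (l t)) := by
  have h2 : ∀ s, l (l s) = s := fun s => (exists_ends a b (l s)).unique (hl (l s))
    ⟨(hl s).1.symm, (stacked a b).symm (hl s).2⟩
  refine ⟨h2, planar_of_prod_eq l h2 ?_⟩
  intro f hf hf2
  classical
  set g : Fin n ⊕ (Fin m ⊕ Fin p) → Equiv.Perm (Fin 3) := fun w =>
    if h : ∃ s, stacked a b (outer n m p s) w then f h.choose else 1 with hg
  have hgf : ∀ s, g (outer n m p s) = f s := by
    intro s
    have h : ∃ s', stacked a b (outer n m p s') (outer n m p s) := ⟨s, (stacked a b).refl _⟩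
    have e : g (outer n m p s) = f h.choose := by simp only [hg]; rw [dif_pos h]
    rw [e]
    by_cases h' : h.choose = s
    · rw [h']
    · have := (exists_ends a b s).unique ⟨h', (stacked a b).symm h.choose_spec⟩ (hl s)
      rw [this, hf]
  have hg2 : ∀ w, g w * g w = 1 := by
    intro w
    simp only [hg]
    split_ifs with h
    · exact hf2 _
    · rfl
  have hgs : ∀ x y, stacked a b x y → g x = g y := by
    intro x y hxy
    have : (fun s => stacked a b (outer n m p s) x) = fun s => stacked a b (outer n m p s) y := by
      funext s
      exact propext ⟨fun h => (stacked a b).trans h hxy,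
        fun h => (stacked a b).trans h ((stacked a b).symm hxy)⟩
    simp only [hg, this]
  have e1 := a.prod_left_eq (fun s => g (Sum.map id Sum.inl s))
    (fun s => (hgs _ _ (Relation.EqvGen.rel _ _ (Step.left s))).symm) (fun s => hg2 _)
  have e2 := b.prod_left_eq (fun s => g (Sum.inr s))
    (fun s => (hgs _ _ (Relation.EqvGen.rel _ _ (Step.right s))).symm) (fun s => hg2 _)
  have e3 := e1.trans e2
  simp only [← hgf]
  exact e3

/-- The concatenation `a b`: two boundary points are linked if they are joined by a curve. -/
noncomputable def comp (a : Diagram n m) (b : Diagram m p) : Diagram n p where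
  link s := (exists_ends a b s).choose
  link_link := (link_spec_aux a b fun s => (exists_ends a b s).choose_spec.1).1
  link_ne s := (exists_ends a b s).choose_spec.1.1
  planar := (link_spec_aux a b fun s => (exists_ends a b s).choose_spec.1).2

theorem comp_link_iff (a : Diagram n m) (b : Diagram m p) (s t : Fin n ⊕ Fin p) :
    (comp a b).link s = t ↔ t ≠ s ∧ stacked a b (outer n m p s) (outer n m p t) := by
  constructor
  · rintro rfl; exact (exists_ends a b s).choose_spec.1
  · intro h; exact ((exists_ends a b s).choose_spec.2 t h).symm

/-- The number of closed loops in the concatenation, that is, of connected components which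
contain no boundary point. -/
noncomputable def loops (a : Diagram n m) (b : Diagram m p) : ℕ :=
  Nat.card {c : Quotient (stacked a b) // ∀ s, Quotient.mk _ (outer n m p s) ≠ c}

/-- The matrix which records the `Bool`-labellings of the boundary points that are constant on
links. Matrix multiplication then gives associativity of concatenation. -/
def mat (a : Diagram n m) : Matrix (Fin n → Bool) (Fin m → Bool) ℕ :=
  fun x y => if ∀ s, Sum.elim x y (a.link s) = Sum.elim x y s then 1 else 0

theorem mat_mul (a : Diagram n m) (b : Diagram m p) :
    mat a * mat b = 2 ^ loops a b • mat (comp a b) := by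
  classical
  ext x z
  rw [Matrix.mul_apply, Matrix.smul_apply]
  simp only [mat, mul_ite, mul_one, mul_zero, ← ite_and]
  rw [Finset.sum_boole]
  set P : (Fin m → Bool) → Prop := fun y => (∀ s, Sum.elim y z (b.link s) = Sum.elim y z s) ∧
    ∀ s, Sum.elim x y (a.link s) = Sum.elim x y s with hP
  have hinv : ∀ y, P y → ∀ u v, stacked a b u v →
      Sum.elim x (Sum.elim y z) u = Sum.elim x (Sum.elim y z) v := by
    intro y hy u v huv
    refine stacked_iff (f := Sum.elim x (Sum.elim y z)) (fun s => ?_) (fun s => ?_) huv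
    · have e : ∀ s : Fin n ⊕ Fin m, Sum.elim x (Sum.elim y z) (Sum.map id Sum.inl s) =
          Sum.elim x y s := by rintro (s | s) <;> rfl
      rw [e, e, hy.2]
    · exact hy.1 s
  have eo : ∀ y s, Sum.elim x (Sum.elim y z) (outer n m p s) = Sum.elim x z s := by
    rintro y (s | s) <;> rfl
  by_cases hxz : ∀ s, Sum.elim x z ((comp a b).link s) = Sum.elim x z s
  · have hcomp : ∀ s t, stacked a b (outer n m p s) (outer n m p t) →
        Sum.elim x z s = Sum.elim x z t := by
      intro s t h
      by_cases hst : t = s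
      · rw [hst]
      · rw [← (comp_link_iff a b s t).2 ⟨hst, h⟩, hxz]
    rw [if_pos hxz]
    simp only [smul_eq_mul, mul_one, Nat.cast_id]
    have hP' : ∀ y, (∀ u v, stacked a b u v →
        Sum.elim x (Sum.elim y z) u = Sum.elim x (Sum.elim y z) v) → P y := by
      intro y hy
      refine ⟨fun s => (hy _ _ (Relation.EqvGen.rel _ _ (Step.right s))).symm, fun s => ?_⟩
      have e : ∀ s : Fin n ⊕ Fin m, Sum.elim x (Sum.elim y z) (Sum.map id Sum.inl s) =
          Sum.elim x y s := by rintro (s | s) <;> rfl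
      rw [← e, ← e]
      exact (hy _ _ (Relation.EqvGen.rel _ _ (Step.left s))).symm
    let F (g : {c : Quotient (stacked a b) // ∀ s, Quotient.mk _ (outer n m p s) ≠ c} → Bool) :
        Quotient (stacked a b) → Bool := fun c =>
      if h : ∃ s, Quotient.mk _ (outer n m p s) = c then Sum.elim x z h.choose
      else g ⟨c, not_exists.1 h⟩
    have hFo : ∀ g s, F g (Quotient.mk _ (outer n m p s)) = Sum.elim x z s := by
      intro g s
      have h : ∃ s', Quotient.mk (stacked a b) (outer n m p s') =
        Quotient.mk _ (outer n m p s) := ⟨s, rfl⟩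
      simp only [F]
      rw [dif_pos h]
      exact hcomp _ _ (Quotient.exact h.choose_spec)
    let Y (g : {c : Quotient (stacked a b) // ∀ s, Quotient.mk _ (outer n m p s) ≠ c} → Bool) :
        Fin m → Bool := fun y => F g (Quotient.mk _ (Sum.inr (Sum.inl y)))
    have hFY : ∀ g w, Sum.elim x (Sum.elim (Y g) z) w = F g (Quotient.mk _ w) := by
      rintro g (w | w | w)
      · exact (hFo g (Sum.inl w)).symm
      · rfl
      · exact (hFo g (Sum.inr w)).symm
    let E : {y // P y} ≃ ({c : Quotient (stacked a b) //
        ∀ s, Quotient.mk _ (outer n m p s) ≠ c} → Bool) := {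
      toFun y c := Quotient.lift (Sum.elim x (Sum.elim y.1 z)) (hinv y.1 y.2) c.1
      invFun g := ⟨Y g, hP' _ fun u v huv => by
        rw [hFY, hFY, Quotient.sound huv]⟩
      left_inv := by
        rintro ⟨y, hy⟩
        ext i
        simp only [Y, F]
        split_ifs with h
        · rw [← eo y]
          exact hinv y hy _ _ (Quotient.exact h.choose_spec)
        · rfl
      right_inv := by
        intro g
        funext c
        obtain ⟨c, hc⟩ := c
        induction c using Quotient.inductionOn with
        | _ w =>
          change Sum.elim x (Sum.elim (Y g) z) w = _
          rw [hFY]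
          simp only [F]
          rw [dif_neg (not_exists.2 hc)] }
    have hcard := Nat.card_congr E
    rw [Nat.card_fun, Nat.card_eq_fintype_card, Fintype.card_subtype] at hcard
    rw [hcard, loops]
    simp
  · rw [if_neg hxz]
    simp only [smul_eq_mul, mul_zero, Nat.cast_id, Finset.card_eq_zero]
    rw [Finset.filter_eq_empty_iff]
    intro y _ hy
    apply hxz
    intro s
    have := ((comp_link_iff a b s _).1 rfl).2
    rw [← eo y, ← eo y]
    exact (hinv y hy _ _ this).symm

theorem eq_of_mat {k l : ℕ} {a b : Diagram n m} (h : 2 ^ k • mat a = 2 ^ l • mat b) :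
    k = l ∧ a = b := by
  have h0 := congrFun (congrFun h fun _ => false) fun _ => false
  have e0 : ∀ s : Fin n ⊕ Fin m,
      Sum.elim (fun _ => false) (fun _ => false) s = false := by rintro (s | s) <;> rfl
  simp only [Matrix.smul_apply, mat, e0] at h0
  simp at h0
  subst h0
  refine ⟨rfl, ?_⟩
  ext s
  have h1 := congrFun (congrFun h fun i => decide (Sum.inl i = s ∨ Sum.inl i = a.link s))
    fun j => decide (Sum.inr j = s ∨ Sum.inr j = a.link s)
  have e1 : ∀ t : Fin n ⊕ Fin m,
      Sum.elim (fun i => decide (Sum.inl i = s ∨ Sum.inl i = a.link s))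
        (fun j => decide (Sum.inr j = s ∨ Sum.inr j = a.link s)) t =
      decide (t = s ∨ t = a.link s) := by rintro (t | t) <;> rfl
  simp only [Matrix.smul_apply, mat, e1] at h1
  have h2 : ∀ t, decide (a.link t = s ∨ a.link t = a.link s) =
      decide (t = s ∨ t = a.link s) := by
    intro t
    rw [decide_eq_decide]
    constructor
    · rintro (h | h)
      · right; rw [← h, a.link_link]
      · left; rw [← a.link_link t, h, a.link_link]
    · rintro (rfl | rfl)
      · right; rfl
      · left; rw [a.link_link]
  rw [if_pos h2] at h1
  split_ifs at h1 with h3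
  · have := h3 s
    rw [decide_eq_decide] at this
    rcases this.2 (Or.inl rfl) with h | h
    · exact absurd h (b.link_ne s)
    · exact h.symm
  · simp at h1

theorem comp_eq_of_mat {k : ℕ} {a : Diagram n m} {b : Diagram m p} {c : Diagram n p}
    (h : mat a * mat b = 2 ^ k • mat c) : loops a b = k ∧ comp a b = c :=
  eq_of_mat (by rw [← mat_mul, h])

theorem comp_assoc_aux {r : ℕ} (a : Diagram n m) (b : Diagram m p) (c : Diagram p r) :
    loops a b + loops (comp a b) c = loops b c + loops a (comp b c) ∧
      comp (comp a b) c = comp a (comp b c) := by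
  apply eq_of_mat
  rw [pow_add, mul_smul, ← mat_mul, ← Matrix.smul_mul, ← mat_mul, pow_add, mul_smul, ← mat_mul,
    ← Matrix.mul_smul, ← mat_mul, Matrix.mul_assoc]

/-- The reflection `a ↦ a^*` through a vertical mirror. -/
def Diagram.reflect (a : Diagram n m) : Diagram m n where
  link s := (a.link s.swap).swap
  link_link s := by simp [a.link_link]
  link_ne s h := a.link_ne s.swap (by rw [← Sum.swap_swap (a.link s.swap), h])
  planar s t := by
    rintro ⟨h1, h2, h3⟩
    have e : ∀ s : Fin m ⊕ Fin n, (pos m n s : ℕ) + pos n m s.swap = n + m - 1 := by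
      rintro (s | s)
      · simp [pos, Fin.val_rev]; omega
      · simp [pos, Fin.val_rev]; omega
    have := a.planar (a.link t.swap) (a.link s.swap)
    rw [Fin.lt_def] at h1 h2 h3
    have k1 := e s
    have k2 := e t
    have k3 := e (a.link s.swap).swap
    have k4 := e (a.link t.swap).swap
    rw [Sum.swap_swap] at k3 k4
    simp only [Fin.lt_def, a.link_link] at this
    apply this
    omega

theorem mat_reflect (a : Diagram n m) : mat a.reflect = (mat a).transpose := by
  ext x y
  have e : ∀ s : Fin n ⊕ Fin m, Sum.elim x y s.swap = Sum.elim y x s := by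
    rintro (s | s) <;> rfl
  simp only [mat, Matrix.transpose_apply, Diagram.reflect, e]
  refine if_congr ⟨fun h s => ?_, fun h s => ?_⟩ rfl rfl
  · have := h s.swap
    rwa [Sum.swap_swap, e] at this
  · rw [h, ← e, Sum.swap_swap]

theorem reflect_reflect (a : Diagram n m) : a.reflect.reflect = a := by
  ext s; simp [Diagram.reflect]

theorem comp_reflect (a : Diagram n m) (b : Diagram m p) :
    loops b.reflect a.reflect = loops a b ∧
      comp b.reflect a.reflect = (comp a b).reflect := by
  apply comp_eq_of_mat
  rw [mat_reflect, mat_reflect, mat_reflect, ← Matrix.transpose_mul, mat_mul,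
    Matrix.transpose_smul]

end Composition

/-- The identity diagram. -/
def Diagram.id (n : ℕ) : Diagram n n where
  link := Sum.swap
  link_link s := by simp
  link_ne s := by rcases s with s | s <;> simp
  planar s t := by
    rintro ⟨h1, h2, h3⟩
    rw [Fin.lt_def] at h1 h2 h3
    rcases s with s | s <;> rcases t with t | t <;>
      simp [pos, Fin.val_rev] at h1 h2 h3 <;> omega

theorem mat_id (n : ℕ) : mat (Diagram.id n) = 1 := by
  ext x y
  simp only [mat, Diagram.id, Matrix.one_apply]
  refine if_congr ⟨fun h => funext fun i => ?_, ?_⟩ rfl rfl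
  · exact (h (Sum.inl i)).symm
  · rintro rfl (s | s) <;> rfl

theorem id_comp_aux {n m : ℕ} (a : Diagram n m) :
    loops (Diagram.id n) a = 0 ∧ comp (Diagram.id n) a = a :=
  comp_eq_of_mat (by rw [mat_id]; simp)

theorem comp_id_aux {n m : ℕ} (a : Diagram n m) :
    loops a (Diagram.id m) = 0 ∧ comp a (Diagram.id m) = a :=
  comp_eq_of_mat (by rw [mat_id]; simp)

/-- The diagram `E_i`, for `1 ≤ i < n`: the points `i` and `i + 1` (numbered from `1`) are linked
on either side, and the other points are linked straight across. -/
def Diagram.gen (n i : ℕ) (hi : 1 ≤ i ∧ i < n) : Diagram n n where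
  link
    | Sum.inl s => if s.val + 1 = i then Sum.inl ⟨i, hi.2⟩
        else if s.val = i then Sum.inl ⟨i - 1, by omega⟩ else Sum.inr s
    | Sum.inr s => if s.val + 1 = i then Sum.inr ⟨i, hi.2⟩
        else if s.val = i then Sum.inr ⟨i - 1, by omega⟩ else Sum.inl s
  link_link s := by
    rcases s with s | s <;> dsimp only <;> split_ifs <;> simp_all [Fin.ext_iff] <;> omega
  link_ne s := by
    rcases s with s | s <;> dsimp only <;> split_ifs <;> simp_all [Fin.ext_iff] <;> omega
  planar s t := by
    rintro ⟨h1, h2, h3⟩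
    rw [Fin.lt_def] at h1 h2 h3
    rcases s with s | s <;> rcases t with t | t <;> dsimp only at h1 h2 h3 <;>
      split_ifs at h1 h2 h3 <;> simp [pos, Fin.val_rev] at h1 h2 h3 <;> omega


/-! ### The Temperley-Lieb algebra -/

/-- The Temperley-Lieb algebra `TL_n(β)`: formal `ℂ`-linear combinations of `(n, n)`-diagrams. -/
def TL (n : ℕ) (_β : ℂ) : Type := Diagram n n →₀ ℂ

noncomputable instance (n : ℕ) (β : ℂ) : AddCommGroup (TL n β) :=
  inferInstanceAs (AddCommGroup (Diagram n n →₀ ℂ))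

noncomputable instance (n : ℕ) (β : ℂ) : Module ℂ (TL n β) :=
  inferInstanceAs (Module ℂ (Diagram n n →₀ ℂ))

/-- Bilinear extension of the composition of diagrams: concatenation, with each closed loop replaced
by a factor `β`. -/
noncomputable def compLin (β : ℂ) (n m p : ℕ) :
    (Diagram n m →₀ ℂ) →ₗ[ℂ] (Diagram m p →₀ ℂ) →ₗ[ℂ] (Diagram n p →₀ ℂ) :=
  Finsupp.linearCombination ℂ fun a =>
    Finsupp.linearCombination ℂ fun b => Finsupp.single (comp a b) (β ^ loops a b)

theorem compLin_single (β : ℂ) {n m p : ℕ} (a : Diagram n m) (b : Diagram m p) (x y : ℂ) :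
    compLin β n m p (Finsupp.single a x) (Finsupp.single b y) =
      Finsupp.single (comp a b) (x * y * β ^ loops a b) := by
  rw [compLin, Finsupp.linearCombination_single, LinearMap.smul_apply,
    Finsupp.linearCombination_single, Finsupp.smul_single, Finsupp.smul_single, smul_eq_mul,
    smul_eq_mul, mul_assoc]

theorem compLin_assoc (β : ℂ) {n m p r : ℕ} (f : Diagram n m →₀ ℂ) (g : Diagram m p →₀ ℂ)
    (h : Diagram p r →₀ ℂ) :
    compLin β n p r (compLin β n m p f g) h = compLin β n m r f (compLin β m p r g h) := by
  induction f using Finsupp.induction_linear with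
  | zero => simp
  | add f f' ih ih' => simp [ih, ih']
  | single a x =>
    induction g using Finsupp.induction_linear with
    | zero => simp
    | add g g' ih ih' => simp [ih, ih']
    | single b y =>
      induction h using Finsupp.induction_linear with
      | zero => simp
      | add h h' ih ih' => simp [ih, ih']
      | single c z =>
        simp only [compLin_single]
        obtain ⟨h1, h2⟩ := comp_assoc_aux a b c
        rw [h2]
        congr 1
        calc x * y * β ^ loops a b * z * β ^ loops (comp a b) c
            = x * y * z * β ^ (loops a b + loops (comp a b) c) := by rw [pow_add]; ring
          _ = _ := by rw [h1, pow_add]; ring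

/-- The coefficients of an element of `TL_n(β)` in the basis of diagrams. -/
noncomputable def TL.coeff (n : ℕ) (β : ℂ) : TL n β ≃ₗ[ℂ] (Diagram n n →₀ ℂ) :=
  LinearEquiv.refl ℂ (Diagram n n →₀ ℂ)

/-- A diagram, as an element of `TL_n(β)`. -/
noncomputable def TL.single {n : ℕ} (β : ℂ) (a : Diagram n n) : TL n β :=
  (TL.coeff n β).symm (Finsupp.single a 1)

theorem id_compLin (β : ℂ) {n m : ℕ} (f : Diagram n m →₀ ℂ) :
    compLin β n n m (Finsupp.single (Diagram.id n) 1) f = f := by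
  induction f using Finsupp.induction_linear with
  | zero => simp
  | add f g hf hg => rw [map_add, hf, hg]
  | single a x => rw [compLin_single, (id_comp_aux a).1, (id_comp_aux a).2]; simp

theorem compLin_id (β : ℂ) {n m : ℕ} (f : Diagram n m →₀ ℂ) :
    compLin β n m m f (Finsupp.single (Diagram.id m) 1) = f := by
  induction f using Finsupp.induction_linear with
  | zero => simp
  | add f g hf hg => rw [map_add, LinearMap.add_apply, hf, hg]
  | single a x => rw [compLin_single, (comp_id_aux a).1, (comp_id_aux a).2]; simp

noncomputable instance (n : ℕ) (β : ℂ) : Mul (TL n β) where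
  mul f g := (TL.coeff n β).symm (compLin β n n n (TL.coeff n β f) (TL.coeff n β g))

noncomputable instance (n : ℕ) (β : ℂ) : One (TL n β) where
  one := TL.single β (Diagram.id n)

theorem TL.coeff_mul {n : ℕ} {β : ℂ} (f g : TL n β) :
    TL.coeff n β (f * g) = compLin β n n n (TL.coeff n β f) (TL.coeff n β g) :=
  LinearEquiv.apply_symm_apply _ _

theorem TL.coeff_single {n : ℕ} (β : ℂ) (a : Diagram n n) :
    TL.coeff n β (TL.single β a) = Finsupp.single a 1 :=
  LinearEquiv.apply_symm_apply _ _

theorem TL.coeff_one (n : ℕ) (β : ℂ) :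
    TL.coeff n β 1 = Finsupp.single (Diagram.id n) 1 := TL.coeff_single β _

noncomputable instance (n : ℕ) (β : ℂ) : Ring (TL n β) where
  __ := (inferInstance : AddCommGroup (TL n β))
  __ := (inferInstance : Mul (TL n β))
  __ := (inferInstance : One (TL n β))
  mul_assoc f g h := (TL.coeff n β).injective (by simp only [TL.coeff_mul, compLin_assoc])
  left_distrib f g h := (TL.coeff n β).injective (by simp only [TL.coeff_mul, map_add])
  right_distrib f g h := (TL.coeff n β).injective
    (by simp only [TL.coeff_mul, map_add, LinearMap.add_apply])
  zero_mul f := (TL.coeff n β).injective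
    (by simp only [TL.coeff_mul, map_zero, LinearMap.zero_apply])
  mul_zero f := (TL.coeff n β).injective (by simp only [TL.coeff_mul, map_zero])
  one_mul f := (TL.coeff n β).injective (by rw [TL.coeff_mul, TL.coeff_one, id_compLin])
  mul_one f := (TL.coeff n β).injective (by rw [TL.coeff_mul, TL.coeff_one, compLin_id])

noncomputable instance (n : ℕ) (β : ℂ) : Algebra ℂ (TL n β) :=
  Algebra.ofModule
    (fun c f g => (TL.coeff n β).injective
      (by simp only [TL.coeff_mul, map_smul, LinearMap.smul_apply]))
    (fun c f g => (TL.coeff n β).injective (by simp only [TL.coeff_mul, map_smul]))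

/-- The generator `E_i` of `TL_n(β)`, `1 ≤ i < n` (and `0` for other `i`). -/
noncomputable def E (n : ℕ) (β : ℂ) (i : ℕ) : TL n β :=
  if hi : 1 ≤ i ∧ i < n then TL.single β (Diagram.gen n i hi) else 0

/-- The `q`-number `[m] = (q^m - q^{-m}) / (q - q⁻¹)`. -/
noncomputable def qnum (q : ℂ) (m : ℕ) : ℂ := (q ^ m - (q ^ m)⁻¹) / (q - q⁻¹)

/-- The Wenzl-Jones projectors `P_k ∈ TL_N(q + q⁻¹)`, acting on the `k` bottom points: `P_1 = 1` and
`P_k = P_{k-1} - ([k-1]/[k]) P_{k-1} E_{N-k+1} P_{k-1}` for `1 < k ≤ N`. -/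
noncomputable def wenzlJones (N : ℕ) (q : ℂ) : ℕ → TL N (q + q⁻¹)
  | 0 => 1
  | 1 => 1
  | k + 2 => wenzlJones N q (k + 1) - (qnum q (k + 1) / qnum q (k + 2)) •
      (wenzlJones N q (k + 1) * E N (q + q⁻¹) (N - (k + 2) + 1) * wenzlJones N q (k + 1))

/-! ### The cellular modules of the Temperley-Lieb algebra -/

/-- An `(n, d)`-diagram is monic if it has `d` links crossing from left to right. -/
def Diagram.Monic {n d : ℕ} (w : Diagram n d) : Prop :=
  ∀ j : Fin d, ∃ i : Fin n, w.link (Sum.inr j) = Sum.inl i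

theorem Diagram.Monic.of_comp {n m d : ℕ} {a : Diagram n m} {w : Diagram m d}
    (h : (comp a w).Monic) : w.Monic := by
  intro j
  rcases hw : w.link (Sum.inr j) with i | j'
  · exact ⟨i, rfl⟩
  · exfalso
    have : (comp a w).link (Sum.inr j) = Sum.inr j' := by
      rw [comp_link_iff]
      refine ⟨fun h => w.link_ne _ (hw.trans (congrArg Sum.inr (Sum.inr_injective h))), ?_⟩
      have := Relation.EqvGen.rel _ _ (Step.right (a := a) (b := w) (Sum.inr j))
      rw [hw] at this
      exact this
    obtain ⟨i, hi⟩ := h j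
    rw [this] at hi
    simp at hi

/-- The cellular module `S_n^d`: the `ℂ`-linear span of the monic `(n, d)`-diagrams. -/
abbrev Cell (n d : ℕ) : Type := {w : Diagram n d // w.Monic} →₀ ℂ

open Classical in
/-- The projection that sets the non-monic diagrams to zero. -/
noncomputable def Cell.proj (n d : ℕ) : (Diagram n d →₀ ℂ) →ₗ[ℂ] Cell n d :=
  Finsupp.linearCombination ℂ fun w => if hw : w.Monic then Finsupp.single ⟨w, hw⟩ 1 else 0

/-- The inclusion of the span of the monic diagrams in that of all diagrams. -/
noncomputable def Cell.incl (n d : ℕ) : Cell n d →ₗ[ℂ] (Diagram n d →₀ ℂ) :=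
  Finsupp.lmapDomain ℂ ℂ Subtype.val

theorem Cell.incl_single {n d : ℕ} (w : {w : Diagram n d // w.Monic}) (x : ℂ) :
    Cell.incl n d (Finsupp.single w x) = Finsupp.single w.1 x := Finsupp.mapDomain_single

theorem Cell.proj_monic {n d : ℕ} {w : Diagram n d} (hw : w.Monic) (x : ℂ) :
    Cell.proj n d (Finsupp.single w x) = Finsupp.single ⟨w, hw⟩ x := by
  rw [Cell.proj, Finsupp.linearCombination_single, dif_pos hw, Finsupp.smul_single, smul_eq_mul,
    mul_one]

theorem Cell.proj_not_monic {n d : ℕ} {w : Diagram n d} (hw : ¬ w.Monic) (x : ℂ) :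
    Cell.proj n d (Finsupp.single w x) = 0 := by
  rw [Cell.proj, Finsupp.linearCombination_single, dif_neg hw, smul_zero]

theorem Cell.proj_incl {n d : ℕ} (v : Cell n d) : Cell.proj n d (Cell.incl n d v) = v := by
  induction v using Finsupp.induction_linear with
  | zero => simp
  | add f g hf hg => rw [map_add, map_add, hf, hg]
  | single w x => rw [Cell.incl_single, Cell.proj_monic w.2]

theorem Cell.proj_comp {n d : ℕ} (β : ℂ) (f : Diagram n n →₀ ℂ) (v : Diagram n d →₀ ℂ) :
    Cell.proj n d (compLin β n n d f (Cell.incl n d (Cell.proj n d v))) =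
      Cell.proj n d (compLin β n n d f v) := by
  induction v using Finsupp.induction_linear with
  | zero => simp
  | add v v' hv hv' => simp only [map_add, hv, hv']
  | single w y =>
    by_cases hw : w.Monic
    · rw [Cell.proj_monic hw, Cell.incl_single]
    · rw [Cell.proj_not_monic hw, map_zero, map_zero, map_zero]
      induction f using Finsupp.induction_linear with
      | zero => simp
      | add f f' hf hf' => rw [map_add, LinearMap.add_apply, map_add, ← hf, ← hf', add_zero]
      | single a x => rw [compLin_single, Cell.proj_not_monic fun h => hw h.of_comp]

/-- The action of `TL_n(β)` on `S_n^d`: composition of diagrams, where the result is set to zero if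
it is not monic. -/
noncomputable instance (n d : ℕ) (β : ℂ) : SMul (TL n β) (Cell n d) where
  smul f v := Cell.proj n d (compLin β n n d (TL.coeff n β f) (Cell.incl n d v))

theorem Cell.smul_def {n d : ℕ} {β : ℂ} (f : TL n β) (v : Cell n d) :
    f • v = Cell.proj n d (compLin β n n d (TL.coeff n β f) (Cell.incl n d v)) := rfl

noncomputable instance (n d : ℕ) (β : ℂ) : Module (TL n β) (Cell n d) where
  one_smul v := by rw [Cell.smul_def, TL.coeff_one, id_compLin, Cell.proj_incl]
  mul_smul f g v := by
    simp only [Cell.smul_def, Cell.proj_comp, TL.coeff_mul, compLin_assoc]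
  smul_zero f := by simp only [Cell.smul_def, map_zero]
  zero_smul v := by simp only [Cell.smul_def, map_zero, LinearMap.zero_apply]
  smul_add f v w := by simp only [Cell.smul_def, map_add]
  add_smul f g v := by simp only [Cell.smul_def, map_add, LinearMap.add_apply]

instance (n d : ℕ) (β : ℂ) : IsScalarTower ℂ (TL n β) (Cell n d) where
  smul_assoc c f v := by simp only [Cell.smul_def, map_smul, LinearMap.smul_apply]

open Classical in
/-- If the `(d, d)`-diagram in `v^* w` is monic, then `v^* w` is `β^p` times the identity diagram,
where `p` is the number of closed loops, and the value is `β^p`; otherwise the value is `0`. -/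
noncomputable def pairing (β : ℂ) {n d : ℕ} (v w : Diagram n d) : ℂ :=
  if (comp v.reflect w).Monic then β ^ loops v.reflect w else 0

/-- The bilinear form on `S_n^d`. -/
noncomputable def form (n d : ℕ) (β : ℂ) : Cell n d →ₗ[ℂ] Cell n d →ₗ[ℂ] ℂ :=
  Finsupp.linearCombination ℂ fun v => Finsupp.linearCombination ℂ fun w => pairing β v.1 w.1

/-- The same form on all `(n, d)`-diagrams; it vanishes on the non-monic ones. -/
noncomputable def formAux (n d : ℕ) (β : ℂ) :
    (Diagram n d →₀ ℂ) →ₗ[ℂ] (Diagram n d →₀ ℂ) →ₗ[ℂ] ℂ :=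
  Finsupp.linearCombination ℂ fun v => Finsupp.linearCombination ℂ fun w => pairing β v w

theorem formAux_single {n d : ℕ} (β : ℂ) (v w : Diagram n d) (x y : ℂ) :
    formAux n d β (Finsupp.single v x) (Finsupp.single w y) = x * y * pairing β v w := by
  rw [formAux, Finsupp.linearCombination_single, LinearMap.smul_apply,
    Finsupp.linearCombination_single, smul_eq_mul, smul_eq_mul, mul_assoc]

theorem form_single {n d : ℕ} (β : ℂ) (v w : {w : Diagram n d // w.Monic}) (x y : ℂ) :
    form n d β (Finsupp.single v x) (Finsupp.single w y) = x * y * pairing β v.1 w.1 := by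
  rw [form, Finsupp.linearCombination_single, LinearMap.smul_apply,
    Finsupp.linearCombination_single, smul_eq_mul, smul_eq_mul, mul_assoc]

theorem Diagram.Monic.reflect {d : ℕ} {c : Diagram d d} (h : c.Monic) : c.reflect.Monic := by
  choose g hg using h
  have hinj : Function.Injective g := by
    intro j j' hjj
    have : c.link (Sum.inr j) = c.link (Sum.inr j') := by rw [hg, hg, hjj]
    have := congrArg c.link this
    rw [c.link_link, c.link_link] at this
    exact Sum.inr_injective this
  intro i
  obtain ⟨j, rfl⟩ := (Finite.injective_iff_surjective.1 hinj) i
  refine ⟨j, ?_⟩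
  change (c.link (Sum.inl (g j))).swap = Sum.inl j
  rw [← hg, c.link_link]
  rfl

theorem pairing_symm (β : ℂ) {n d : ℕ} (v w : Diagram n d) : pairing β v w = pairing β w v := by
  obtain ⟨h1, h2⟩ := comp_reflect v.reflect w
  rw [reflect_reflect] at h1 h2
  have h3 : (comp v.reflect w).reflect.Monic ↔ (comp v.reflect w).Monic :=
    ⟨fun h => by have := h.reflect; rwa [reflect_reflect] at this, fun h => h.reflect⟩
  unfold pairing
  rw [h2, h1]
  by_cases h : (comp v.reflect w).Monic
  · rw [if_pos h, if_pos (h3.2 h)]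
  · rw [if_neg h, if_neg (mt h3.1 h)]

theorem pairing_eq_zero (β : ℂ) {n d : ℕ} (v : Diagram n d) {w : Diagram n d} (hw : ¬ w.Monic) :
    pairing β v w = 0 := if_neg fun h => hw h.of_comp

theorem form_proj (n d : ℕ) (β : ℂ) (v w : Diagram n d →₀ ℂ) :
    form n d β (Cell.proj n d v) (Cell.proj n d w) = formAux n d β v w := by
  induction v using Finsupp.induction_linear with
  | zero => simp
  | add f g hf hg => simp only [map_add, LinearMap.add_apply, hf, hg]
  | single v x =>
    induction w using Finsupp.induction_linear with
    | zero => simp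
    | add f g hf hg => simp only [map_add, hf, hg]
    | single w y =>
      rw [formAux_single]
      by_cases hv : v.Monic
      · by_cases hw : w.Monic
        · rw [Cell.proj_monic hv, Cell.proj_monic hw, form_single]
        · rw [Cell.proj_not_monic hw, pairing_eq_zero β v hw, map_zero, mul_zero]
      · rw [Cell.proj_not_monic hv, pairing_symm, pairing_eq_zero β w hv, map_zero,
          LinearMap.zero_apply, mul_zero]

/-- The anti-involution `f ↦ f^*` of `TL_n(β)`, reflection of diagrams through a vertical mirror. -/
noncomputable def TL.reflect (n : ℕ) (β : ℂ) : TL n β →ₗ[ℂ] TL n β :=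
  (TL.coeff n β).symm.toLinearMap ∘ₗ Finsupp.lmapDomain ℂ ℂ Diagram.reflect ∘ₗ
    (TL.coeff n β).toLinearMap

theorem TL.coeff_reflect {n : ℕ} {β : ℂ} (f : TL n β) : TL.coeff n β (TL.reflect n β f) =
    Finsupp.lmapDomain ℂ ℂ Diagram.reflect (TL.coeff n β f) :=
  LinearEquiv.apply_symm_apply _ _

theorem TL.reflect_mul {n : ℕ} {β : ℂ} (f g : TL n β) :
    TL.reflect n β (f * g) = TL.reflect n β g * TL.reflect n β f := by
  apply (TL.coeff n β).injective
  rw [TL.coeff_reflect, TL.coeff_mul, TL.coeff_mul, TL.coeff_reflect, TL.coeff_reflect]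
  generalize TL.coeff n β f = f
  generalize TL.coeff n β g = g
  induction f using Finsupp.induction_linear with
  | zero => simp
  | add f f' hf hf' => simp only [map_add, LinearMap.add_apply, hf, hf']
  | single a x =>
    induction g using Finsupp.induction_linear with
    | zero => simp
    | add g g' hg hg' => simp only [map_add, LinearMap.add_apply, hg, hg']
    | single b y =>
      simp only [compLin_single, Finsupp.lmapDomain_apply, Finsupp.mapDomain_single]
      rw [(comp_reflect a b).1, (comp_reflect a b).2, mul_comm x y]

theorem TL.reflect_single {n : ℕ} (β : ℂ) {a : Diagram n n} (ha : a.reflect = a) :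
    TL.reflect n β (TL.single β a) = TL.single β a := by
  apply (TL.coeff n β).injective
  rw [TL.coeff_reflect, TL.coeff_single, Finsupp.lmapDomain_apply, Finsupp.mapDomain_single, ha]

theorem TL.reflect_one (n : ℕ) (β : ℂ) : TL.reflect n β 1 = 1 :=
  TL.reflect_single β (by ext s; simp [Diagram.reflect, Diagram.id])

theorem TL.reflect_E (n : ℕ) (β : ℂ) (i : ℕ) : TL.reflect n β (E n β i) = E n β i := by
  by_cases hi : 1 ≤ i ∧ i < n
  · rw [E, dif_pos hi]
    apply TL.reflect_single
    ext s
    rcases s with s | s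
    · change ((Diagram.gen n i hi).link (Sum.inr s)).swap = (Diagram.gen n i hi).link (Sum.inl s)
      simp only [Diagram.gen]
      split_ifs <;> rfl
    · change ((Diagram.gen n i hi).link (Sum.inl s)).swap = (Diagram.gen n i hi).link (Sum.inr s)
      simp only [Diagram.gen]
      split_ifs <;> rfl
  · rw [E, dif_neg hi, map_zero]

theorem reflect_wenzlJones (N : ℕ) (q : ℂ) (k : ℕ) :
    TL.reflect N (q + q⁻¹) (wenzlJones N q k) = wenzlJones N q k := by
  induction k using wenzlJones.induct with
  | case1 => exact TL.reflect_one _ _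
  | case2 => exact TL.reflect_one _ _
  | case3 k ih =>
    rw [wenzlJones, map_sub, map_smul, TL.reflect_mul, TL.reflect_mul, TL.reflect_E, ih, mul_assoc]

theorem form_smul {n d : ℕ} {β : ℂ} (f : TL n β) (v w : Cell n d) :
    form n d β (f • v) w = form n d β v (TL.reflect n β f • w) := by
  rw [Cell.smul_def, Cell.smul_def, TL.coeff_reflect]
  conv_lhs => rw [← Cell.proj_incl w]
  conv_rhs => rw [← Cell.proj_incl v]
  rw [form_proj, form_proj]
  generalize Cell.incl n d v = v
  generalize Cell.incl n d w = w
  generalize TL.coeff n β f = f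
  induction f using Finsupp.induction_linear with
  | zero => simp
  | add f f' hf hf' => simp only [map_add, LinearMap.add_apply, hf, hf']
  | single a x =>
    induction v using Finsupp.induction_linear with
    | zero => simp
    | add v v' hv hv' => simp only [map_add, LinearMap.add_apply, hv, hv']
    | single v y =>
      induction w using Finsupp.induction_linear with
      | zero => simp
      | add w w' hw hw' => simp only [map_add, hw, hw']
      | single w z =>
        rw [Finsupp.lmapDomain_apply, Finsupp.mapDomain_single, compLin_single, compLin_single,
          formAux_single, formAux_single]
        obtain ⟨h1, h2⟩ := comp_reflect a v
        obtain ⟨h3, h4⟩ := comp_assoc_aux v.reflect a.reflect w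
        unfold pairing
        rw [← h2, h4]
        split_ifs with hm
        · calc _ = x * y * z * β ^ (loops v.reflect a.reflect +
                loops (comp v.reflect a.reflect) w) := by rw [pow_add, h1]; ring
            _ = _ := by rw [h3, pow_add]; ring
        · simp

/-- The radical `R_n^d` of the bilinear form on `S_n^d`, a `TL_n(β)`-submodule. -/
def radical (n d : ℕ) (β : ℂ) : Submodule (TL n β) (Cell n d) where
  carrier := {v | ∀ w, form n d β v w = 0}
  zero_mem' w := by simp
  add_mem' hv hv' w := by rw [map_add, LinearMap.add_apply, hv w, hv' w, add_zero]
  smul_mem' f v hv w := by rw [form_smul, hv]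

/-! ### Restriction to `eAe` -/

section Restriction

variable {A : Type*} [Ring A] {e : A}

/-- The value `eV` of the restriction functor `res_e` on an `A`-module `V`, for an idempotent
`e ∈ A`. It is a module over `eAe` (`he.Corner`), a ring with identity `e`. -/
def Res (_he : IsIdempotentElem e) (V : Type*) [AddCommGroup V] [Module A V] : Type _ :=
  (DistribSMul.toAddMonoidHom V e).range

variable (he : IsIdempotentElem e) (V : Type*) [AddCommGroup V] [Module A V]

instance : AddCommGroup (Res he V) :=
  inferInstanceAs (AddCommGroup (DistribSMul.toAddMonoidHom V e).range)

/-- The inclusion `eV ⊆ V`. -/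
def Res.incl : Res he V →+ V := (DistribSMul.toAddMonoidHom V e).range.subtype

theorem Res.incl_injective : Function.Injective (Res.incl he V) := Subtype.val_injective

variable {V} in
/-- The element `e v` of `eV`. -/
def Res.mk (v : V) : Res he V := ⟨e • v, v, rfl⟩

theorem Res.incl_mk (v : V) : Res.incl he V (Res.mk he v) = e • v := rfl

theorem Res.mk_surjective : Function.Surjective (Res.mk (V := V) he) := by
  rintro ⟨_, v, rfl⟩
  exact ⟨v, rfl⟩

theorem Res.smul_incl (v : Res he V) : e • Res.incl he V v = Res.incl he V v := by
  obtain ⟨v, rfl⟩ := Res.mk_surjective he V v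
  rw [Res.incl_mk, smul_smul, he.eq]

/-- The elements of `eAe ⊆ A` act on `eV ⊆ V` as they do on `V`. -/
instance : SMul he.Corner (Res he V) where
  smul b v := Res.mk he ((b.1 : A) • Res.incl he V v)

theorem Res.incl_smul (b : he.Corner) (v : Res he V) :
    Res.incl he V (b • v) = (b.1 : A) • Res.incl he V v := by
  change e • (b.1 : A) • Res.incl he V v = _
  rw [smul_smul, ((Subsemigroup.mem_corner_iff he).1 b.2).1]

instance : Module he.Corner (Res he V) where
  one_smul v := Res.incl_injective he V (by
    rw [Res.incl_smul]; exact Res.smul_incl he V v)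
  mul_smul b c v := Res.incl_injective he V (by
    rw [Res.incl_smul, Res.incl_smul, Res.incl_smul, smul_smul]; rfl)
  smul_zero b := Res.incl_injective he V (by rw [Res.incl_smul, map_zero, smul_zero])
  zero_smul v := Res.incl_injective he V (by
    rw [Res.incl_smul, map_zero]; exact zero_smul A _)
  smul_add b v w := Res.incl_injective he V (by
    rw [Res.incl_smul, map_add, map_add, Res.incl_smul, Res.incl_smul, smul_add])
  add_smul b c v := Res.incl_injective he V (by
    rw [Res.incl_smul, map_add, Res.incl_smul, Res.incl_smul]; exact add_smul _ _ _)

end Restriction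

/-! ### The boundary seam algebras -/

section Seam

variable {n k : ℕ} {q : ℂ}

/-- The boundary seam algebra `b_{n,k} = P_k TL_{n+k} P_k`, with identity `P_k`. -/
abbrev SeamAlgebra (hP : IsIdempotentElem (wenzlJones (n + k) q k)) : Type := hP.Corner

/-- The cellular module `S_{n,k}^d` over `b_{n,k}`: the span of the elements `P_k w`, for `w` a monic
`(n + k, d)`-diagram (see `range_seamCell`), on which `b_{n,k}` acts by composition of diagrams. -/
abbrev SeamCell (hP : IsIdempotentElem (wenzlJones (n + k) q k)) (d : ℕ) : Type :=
  Res hP (Cell (n + k) d)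

theorem range_seamCell (hP : IsIdempotentElem (wenzlJones (n + k) q k)) (d : ℕ) :
    Set.range (Res.incl hP (Cell (n + k) d)) =
      Submodule.span ℂ (Set.range fun w : {w : Diagram (n + k) d // w.Monic} =>
        wenzlJones (n + k) q k • (Finsupp.single w 1 : Cell (n + k) d)) := by
  have hsm : ∀ (c : ℂ) (v : Cell (n + k) d),
      wenzlJones (n + k) q k • c • v = c • wenzlJones (n + k) q k • v := fun c v => by
    simp only [Cell.smul_def, map_smul]
  ext v
  constructor
  · rintro ⟨x, rfl⟩
    obtain ⟨v, rfl⟩ := Res.mk_surjective hP _ x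
    rw [Res.incl_mk, SetLike.mem_coe]
    induction v using Finsupp.induction_linear with
    | zero => rw [smul_zero]; exact zero_mem _
    | add u v hu hv => rw [smul_add]; exact add_mem hu hv
    | single w c =>
      rw [← mul_one c, ← smul_eq_mul, ← Finsupp.smul_single, hsm]
      exact Submodule.smul_mem _ _ (Submodule.subset_span ⟨w, rfl⟩)
  · intro hv
    refine Submodule.span_induction ?_ ?_ ?_ ?_ hv
    · rintro _ ⟨w, rfl⟩
      exact ⟨Res.mk hP _, rfl⟩
    · exact ⟨0, map_zero _⟩
    · rintro _ _ _ _ ⟨x, rfl⟩ ⟨y, rfl⟩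
      exact ⟨x + y, map_add _ _ _⟩
    · rintro c _ _ ⟨x, rfl⟩
      refine ⟨Res.mk hP (c • Res.incl hP _ x), ?_⟩
      rw [Res.incl_mk, hsm, Res.smul_incl]

/-- The bilinear form on `S_{n,k}^d`: the pairing of `P_k v` and `P_k w` is the factor in front of
the monic `(d, d)`-diagram in `(P_k v)^* (P_k w)`. -/
noncomputable def seamForm (hP : IsIdempotentElem (wenzlJones (n + k) q k)) (d : ℕ)
    (x y : SeamCell hP d) : ℂ :=
  form (n + k) d (q + q⁻¹) (Res.incl hP _ x) (Res.incl hP _ y)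

/-- The radical `R_{n,k}^d` of the bilinear form on `S_{n,k}^d`, a `b_{n,k}`-submodule. -/
def seamRadical (hP : IsIdempotentElem (wenzlJones (n + k) q k)) (d : ℕ) :
    Submodule (SeamAlgebra hP) (SeamCell hP d) where
  carrier := {x | ∀ y, seamForm hP d x y = 0}
  zero_mem' y := by simp [seamForm]
  add_mem' hx hx' y := by
    have h1 := hx y
    have h2 := hx' y
    unfold seamForm at *
    rw [map_add, map_add, LinearMap.add_apply, h1, h2, add_zero]
  smul_mem' b x hx y := by
    unfold seamForm
    have h := hx (Res.mk hP (TL.reflect _ _ b.1 • Res.incl hP _ y))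
    unfold seamForm at h
    rw [Res.incl_mk] at h
    have h1 := form_smul (wenzlJones (n + k) q k) (Res.incl hP _ x)
      (TL.reflect _ _ b.1 • Res.incl hP _ y)
    rw [reflect_wenzlJones, h, Res.smul_incl] at h1
    rw [Res.incl_smul, form_smul, h1]

/-- The set `Δ_{n,k}`. -/
def Delta (n k : ℕ) : Set ℕ := {d | d ≤ n + k ∧ d ≡ n + k [MOD 2] ∧ k ≤ n + d}

/-- The set of the `d ∈ Δ_{n,k}` for which the form on `S_{n,k}^d` is not identically zero. -/
def Delta0 (hP : IsIdempotentElem (wenzlJones (n + k) q k)) : Set ℕ :=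
  {d ∈ Delta n k | ∃ x y : SeamCell hP d, seamForm hP d x y ≠ 0}

end Seam

end TemperleyLieb

open TemperleyLieb

/-! The statement rests on two facts about `P = P_k`: it is idempotent, and it is fixed by the
reflection `*`, hence self-adjoint for the form on `S_N^d`.

Idempotence goes by induction on the projectors (`wenzlJones_spec`), together with the absorption
`P_k P_{k+1} = P_{k+1}` and the identity `E P_{k+1} E = ([k+2]/[k+1]) E P_k`, where `E =
E_{N-(k+1)}`. The hypothesis on `q` keeps the denominators nonzero. The induction needs the
Temperley-Lieb relations. These are read off from the matrices `mat`, in which a closed loop counts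
as the factor 2: an equality of multiples of such matrices by powers of 2 determines both the
diagram and the number of loops (`eq_of_mat`), so it transfers to every `β`.

For (a), if `x` lies in `P S`, then `⟨x, y⟩ = ⟨P x, y⟩ = ⟨x, P y⟩`. So `x` is orthogonal to `P S`
exactly when it is orthogonal to all of `S` (`mem_seamRadical_iff`). The radical of the restricted
form is therefore the intersection of `P S` with the radical `R`, and this intersection is `P R`
(`exists_res_equiv`).

For (b), the cellular structure gives `(u y^*) x = ⟨y, x⟩ u` (`rankOne_smul`). A vector outside the
radical thus generates the whole module, so when the form is not zero its radical is the largest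
proper submodule, which is the Jacobson radical. The argument works over `TL_N` (`jacobson_cell`),
and also over `b_{n,k}` after cutting `u y^*` down to `P u y^* P` (`jacobson_seamCell`). Thus (b)
reduces to (a). -/

namespace TemperleyLieb

/-! ### The Temperley-Lieb relations -/

section Relations

variable {n : ℕ}

/-- The labelling `x` changed to the value `c` at the two points `a` and `b`. -/
def setPair (a b : Fin n) (x : Fin n → Bool) (c : Bool) : Fin n → Bool :=
  fun j => if j = a ∨ j = b then c else x j

/-- The action on functions of labellings of a diagram that links `a` to `b` on either side. -/
def pairOp (a b : Fin n) (f : (Fin n → Bool) → ℕ) (x : Fin n → Bool) : ℕ :=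
  if x a = x b then f (setPair a b x true) + f (setPair a b x false) else 0

/-- The left cup imposes one equation on `x`, the right cup leaves one free value `c` for `y`, and
the straight links force `y = x` elsewhere. `E_i` counts points from 1 and `Fin n` from 0, hence the
pair `i - 1`, `i`. -/
theorem gen_label_iff {i : ℕ} (hi : 1 ≤ i ∧ i < n) (x y : Fin n → Bool) :
    (∀ s, Sum.elim x y ((Diagram.gen n i hi).link s) = Sum.elim x y s) ↔
      x ⟨i - 1, by omega⟩ = x ⟨i, hi.2⟩ ∧
        ∃ c, y = setPair ⟨i - 1, by omega⟩ ⟨i, hi.2⟩ x c := by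
  constructor
  · intro h
    have h1 := h (Sum.inl ⟨i - 1, by omega⟩)
    have h2 := h (Sum.inr ⟨i - 1, by omega⟩)
    have e : i - 1 + 1 = i := by omega
    simp only [Diagram.gen, e, if_true, Sum.elim_inl, Sum.elim_inr] at h1 h2
    refine ⟨h1.symm, y ⟨i, hi.2⟩, funext fun j => ?_⟩
    unfold setPair
    split_ifs with hj
    · rcases hj with rfl | rfl
      · exact h2.symm
      · rfl
    · have h3 := h (Sum.inr j)
      have e1 : ¬ j.val + 1 = i := fun hh => hj (Or.inl (Fin.ext (by simp; omega)))
      have e2 : ¬ j.val = i := fun hh => hj (Or.inr (Fin.ext hh))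
      simpa [Diagram.gen, e1, e2] using h3.symm
  · rintro ⟨h, c, rfl⟩ (s | s)
    · simp only [Diagram.gen]
      split_ifs with h1 h2
      · have : s = ⟨i - 1, by omega⟩ := Fin.ext (by simp; omega)
        simp [this, h]
      · have : s = ⟨i, hi.2⟩ := Fin.ext h2
        simp [this, h]
      · have e1 : ¬ (s = ⟨i - 1, by omega⟩ ∨ s = ⟨i, hi.2⟩) := by
          simp only [Fin.ext_iff]; omega
        simp [setPair, e1]
    · simp only [Diagram.gen]
      split_ifs with h1 h2
      · have : s = ⟨i - 1, by omega⟩ := Fin.ext (by simp; omega)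
        simp [this, setPair]
      · have : s = ⟨i, hi.2⟩ := Fin.ext h2
        simp [this, setPair]
      · have e1 : ¬ (s = ⟨i - 1, by omega⟩ ∨ s = ⟨i, hi.2⟩) := by
          simp only [Fin.ext_iff]; omega
        simp [setPair, e1]

/-- Turns the relations between generators into identities between operators on functions, so that
no curve in a stacked diagram has to be followed. -/
theorem mat_gen_mulVec {i : ℕ} (hi : 1 ≤ i ∧ i < n) (f : (Fin n → Bool) → ℕ) :
    (mat (Diagram.gen n i hi)).mulVec f = pairOp ⟨i - 1, by omega⟩ ⟨i, hi.2⟩ f := by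
  funext x
  simp only [Matrix.mulVec, dotProduct, mat, gen_label_iff, pairOp, ite_mul, one_mul, zero_mul]
  split_ifs with h
  · have hne : setPair ⟨i - 1, by omega⟩ ⟨i, hi.2⟩ x true ≠
        setPair ⟨i - 1, by omega⟩ ⟨i, hi.2⟩ x false := fun h => by
      simpa [setPair] using congrFun h ⟨i, hi.2⟩
    rw [← Finset.sum_filter, ← Finset.sum_pair hne]
    refine Finset.sum_congr ?_ fun _ _ => rfl
    ext y
    simp [h, or_comm]
  · simp [h]

theorem matrix_ext_mulVec {ι : Type*} [Fintype ι] {A B : Matrix ι ι ℕ}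
    (h : ∀ f, A.mulVec f = B.mulVec f) : A = B := by
  classical
  exact Matrix.ext_of_mulVec_single fun i => h _

/-- After the outer operator the labels at `a` and `b` agree, so the inner test always succeeds, and
the inner choice overwrites the outer one. The same sum is therefore counted twice. -/
theorem pairOp_pairOp_self (a b : Fin n) (f : (Fin n → Bool) → ℕ) :
    pairOp a b (pairOp a b f) = 2 • pairOp a b f := by
  funext x
  have e : ∀ c c', setPair a b (setPair a b x c) c' = setPair a b x c' := by
    intro c c'; funext j; simp only [setPair]; split_ifs <;> rfl
  have e1 : ∀ c, setPair a b x c a = setPair a b x c b := fun c => by simp [setPair]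
  simp only [pairOp, e, e1, if_true, Pi.smul_apply, smul_eq_mul]
  split_ifs <;> omega

theorem pairOp_comm {a b c d : Fin n} (hac : a ≠ c) (had : a ≠ d) (hbc : b ≠ c) (hbd : b ≠ d)
    (f : (Fin n → Bool) → ℕ) : pairOp a b (pairOp c d f) = pairOp c d (pairOp a b f) := by
  funext x
  have e : ∀ u v, setPair c d (setPair a b x u) v = setPair a b (setPair c d x v) u := by
    intro u v; funext j; simp only [setPair]; split_ifs <;> grind
  have e1 : ∀ u, setPair a b x u c = x c := fun u => by simp [setPair, hac.symm, hbc.symm]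
  have e2 : ∀ u, setPair a b x u d = x d := fun u => by simp [setPair, had.symm, hbd.symm]
  have e3 : ∀ u, setPair c d x u a = x a := fun u => by simp [setPair, hac, had]
  have e4 : ∀ u, setPair c d x u b = x b := fun u => by simp [setPair, hbc, hbd]
  simp only [pairOp, e1, e2, e3, e4, e]
  split_ifs <;> omega

/-- The two pairs share exactly one point. Of the four choices made by the two outer operators, the
tests leave a single one, and it changes nothing that the innermost operator does not overwrite. -/
theorem pairOp_braid {a b a' b' : Fin n} (hab : a ≠ b) (hab' : a' ≠ b')
    (h : (a' = b ∧ b' ≠ a) ∨ (b' = a ∧ a' ≠ b)) (f : (Fin n → Bool) → ℕ) :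
    pairOp a b (pairOp a' b' (pairOp a b f)) = pairOp a b f := by
  funext x
  -- The last choice at `a`, `b` overwrites the first one, so `u` drops out of the argument of `f`
  -- and survives only in the tests.
  have e : ∀ u v w, setPair a b (setPair a' b' (setPair a b x u) v) w =
      setPair a b (setPair a' b' x v) w := by
    intro u v w; funext j; simp only [setPair]; split_ifs <;> grind
  have e1 : ∀ u, setPair a b x u a = u := fun u => by simp [setPair]
  have e2 : ∀ u, setPair a b x u b = u := fun u => by simp [setPair]
  have e3 : ∀ y v, setPair a' b' y v a' = v := fun y v => by simp [setPair]
  have e4 : ∀ y v, setPair a' b' y v b' = v := fun y v => by simp [setPair]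
  simp only [pairOp, e]
  rcases h with ⟨rfl, h⟩ | ⟨rfl, h⟩
  -- With `a'` the shared point, the middle test reads `u = x b'` and the innermost one `u = v`.
  -- Hence `v = x b'`, which leaves `b'` unchanged, while `a'` is overwritten afterwards.
  · have e' : ∀ w, setPair a a' (setPair a' b' x (x b')) w = setPair a a' x w := by
      intro w; funext j; simp only [setPair]; split_ifs <;> grind
    have e5 : ∀ u, setPair a a' x u b' = x b' := fun u => by simp [setPair, h, hab'.symm]
    have e6 : ∀ u v, setPair a' b' (setPair a a' x u) v a = u := fun u v => by
      simp [setPair, h.symm, hab]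
    simp only [e2, e3, e5, e6]
    rcases hb : x b' with _ | _ <;> rw [hb] at e' <;> simp [e']
  · have e' : ∀ w, setPair b' b (setPair a' b' x (x a')) w = setPair b' b x w := by
      intro w; funext j; simp only [setPair]; split_ifs <;> grind
    have e5 : ∀ u, setPair b' b x u a' = x a' := fun u => by simp [setPair, h, hab']
    have e6 : ∀ u v, setPair a' b' (setPair b' b x u) v b = u := fun u v => by
      simp [setPair, h.symm, hab.symm]
    simp only [e1, e4, e5, e6]
    rcases hb : x a' with _ | _ <;> rw [hb] at e' <;> simp [e']

end Relations

end TemperleyLieb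

namespace TemperleyLieb

/-! ### Idempotence of the Wenzl-Jones projectors -/

theorem E_mul_self (N : ℕ) (β : ℂ) (i : ℕ) : E N β i * E N β i = β • E N β i := by
  by_cases hi : 1 ≤ i ∧ i < N
  · simp only [E, dif_pos hi]
    -- The exponent `k := 1` records the one closed loop: the factor 2 of `pairOp_pairOp_self`
    -- becomes one factor `β`.
    obtain ⟨h1, h2⟩ := comp_eq_of_mat (a := Diagram.gen N i hi) (b := Diagram.gen N i hi)
      (c := Diagram.gen N i hi) (k := 1) (matrix_ext_mulVec fun f => by
        rw [← Matrix.mulVec_mulVec, Matrix.smul_mulVec, mat_gen_mulVec, mat_gen_mulVec,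
          pairOp_pairOp_self, pow_one])
    apply (TL.coeff N β).injective
    rw [TL.coeff_mul, map_smul, TL.coeff_single, compLin_single, h1, h2]
    simp
  · simp [E, hi]

theorem E_comm (N : ℕ) (β : ℂ) {i j : ℕ} (hij : i + 2 ≤ j) : Commute (E N β i) (E N β j) := by
  by_cases hi : 1 ≤ i ∧ i < N
  · by_cases hj : 1 ≤ j ∧ j < N
    · simp only [E, dif_pos hi, dif_pos hj]
      have key : mat (Diagram.gen N i hi) * mat (Diagram.gen N j hj) =
          mat (Diagram.gen N j hj) * mat (Diagram.gen N i hi) := matrix_ext_mulVec fun f => by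
        rw [← Matrix.mulVec_mulVec, ← Matrix.mulVec_mulVec]
        simp only [mat_gen_mulVec]
        apply pairOp_comm <;> simp only [Ne, Fin.ext_iff] <;> omega
      -- With only the right-hand side expanded, `key` has the form that `comp_eq_of_mat` reads:
      -- both orders give the same diagram and the same number of loops.
      rw [mat_mul (Diagram.gen N j hj)] at key
      obtain ⟨h1, h2⟩ := comp_eq_of_mat key
      apply (TL.coeff N β).injective
      rw [TL.coeff_mul, TL.coeff_mul, TL.coeff_single, TL.coeff_single, compLin_single,
        compLin_single, h1, h2]
    · simp [E, hj]
  · simp [E, hi]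

/-- The upper bound on `j` matters: `E` is zero outside its range, and the left side would then
vanish even when `E_i` does not. -/
theorem E_braid (N : ℕ) (β : ℂ) {i j : ℕ} (hij : j = i + 1) (hi : 1 ≤ i) (hj : j < N) :
    E N β i * E N β j * E N β i = E N β i := by
  have hi' : 1 ≤ i ∧ i < N := by omega
  have hj' : 1 ≤ j ∧ j < N := by omega
  simp only [E, dif_pos hi', dif_pos hj']
  have key : mat (Diagram.gen N i hi') * mat (Diagram.gen N j hj') * mat (Diagram.gen N i hi') =
      mat (Diagram.gen N i hi') := matrix_ext_mulVec fun f => by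
    rw [← Matrix.mulVec_mulVec, ← Matrix.mulVec_mulVec]
    simp only [mat_gen_mulVec]
    apply pairOp_braid <;> simp only [Ne, Fin.ext_iff] <;> omega
  -- The exponent of 2 is now the total number of loops in the triple product; comparison with `2 ^
  -- 0` shows that there are none.
  rw [mat_mul, Matrix.smul_mul, mat_mul, smul_smul, ← pow_add] at key
  obtain ⟨h1, h2⟩ := eq_of_mat (l := 0) (b := Diagram.gen N i hi') (key.trans (by simp))
  apply (TL.coeff N β).injective
  rw [TL.coeff_mul, TL.coeff_mul, TL.coeff_single, TL.coeff_single, compLin_single,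
    compLin_single, h2]
  simp only [mul_one, one_mul]
  rw [← pow_add, h1, pow_zero]

/-- Only numerators are compared, so the recursion also holds at `q = ±1`, where division by zero
makes every `qnum` zero. -/
theorem qnum_rec (q : ℂ) (hq : q ≠ 0) (m : ℕ) :
    (q + q⁻¹) * qnum q (m + 1) = qnum q (m + 2) + qnum q m := by
  simp only [qnum, mul_div_assoc', ← add_div]
  congr 1
  field_simp
  ring

theorem qnum_ne_zero {q : ℂ} (hq : q ≠ 0) (h1 : q ^ 2 ≠ 1) {m : ℕ} (hm : q ^ (2 * m) ≠ 1) :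
    qnum q m ≠ 0 := by
  have aux : ∀ {m : ℕ}, q ^ (2 * m) ≠ 1 → q ^ m - (q ^ m)⁻¹ ≠ 0 := by
    intro m hm h
    apply hm
    have h0 : q ^ m ≠ 0 := pow_ne_zero _ hq
    rw [sub_eq_zero, eq_comm, inv_eq_iff_eq_inv] at h
    rw [two_mul, pow_add]
    nth_rw 1 [h]
    exact inv_mul_cancel₀ h0
  refine div_ne_zero (aux hm) ?_
  simpa using aux (m := 1) (by simpa using h1)

/-- `P_j` is built from the generators with indices from `N - j + 1` to `N - 1`, all at distance at
least 2 from `N - i`. -/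
theorem commute_wenzlJones (N : ℕ) (q : ℂ) (j i : ℕ) (hij : j < i) (hi : i < N) :
    Commute (E N (q + q⁻¹) (N - i)) (wenzlJones N q j) := by
  induction j using wenzlJones.induct with
  | case1 => exact Commute.one_right _
  | case2 => exact Commute.one_right _
  | case3 k ih =>
    have h := ih (by omega)
    have hE : Commute (E N (q + q⁻¹) (N - i)) (E N (q + q⁻¹) (N - (k + 2) + 1)) :=
      E_comm N _ (by omega)
    rw [wenzlJones]
    exact h.sub_right (((h.mul_right hE).mul_right h).smul_right _)

/-- One step of the recursion for the Wenzl-Jones projectors: `p`, `p'` are consecutive projectors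
and `f` the next generator. -/
theorem isIdempotentElem_wenzlJones_step {A : Type*} [Ring A] [Algebra ℂ A] {p p' f : A} {c : ℂ}
    (hc : c ≠ 0) (hp' : p' * p' = p') (hpp : p * p' = p') (hf : f * p' * f = c⁻¹ • (f * p)) :
    (p' - c • (p' * f * p')) * (p' - c • (p' * f * p')) = p' - c • (p' * f * p') := by
  have h1 : p' * (p' * f * p') = p' * f * p' := by rw [← mul_assoc, ← mul_assoc, hp']
  have h2 : p' * f * p' * p' = p' * f * p' := by rw [mul_assoc, hp']
  -- This makes `c • (p' f p')` an idempotent, and `h1`, `h2` place it below `p'`; the difference is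
  -- then an idempotent too.
  have h3 : p' * f * p' * (p' * f * p') = c⁻¹ • (p' * f * p') := by
    calc p' * f * p' * (p' * f * p') = p' * (f * (p' * p') * f) * p' := by noncomm_ring
      _ = c⁻¹ • (p' * f * (p * p')) := by
        rw [hp', hf, mul_smul_comm, smul_mul_assoc]; congr 1; noncomm_ring
      _ = _ := by rw [hpp]
  rw [sub_mul, mul_sub, mul_sub, hp', mul_smul_comm, smul_mul_assoc, h1, h2, smul_mul_assoc,
    mul_smul_comm, h3, smul_inv_smul₀ hc, sub_self, sub_zero]

/-- The three parts feed one another: absorption and the third identity give idempotence at the next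
stage. Since `[k+2]` occurs only in a numerator, it may vanish, which allows the last projector just
below the root of unity. -/
theorem wenzlJones_spec (N : ℕ) {q : ℂ} (hq : q ≠ 0) (k : ℕ) (hkN : k + 1 < N)
    (h : ∀ m, 1 ≤ m → m ≤ k + 1 → qnum q m ≠ 0) :
    wenzlJones N q (k + 1) * wenzlJones N q (k + 1) = wenzlJones N q (k + 1) ∧
    wenzlJones N q k * wenzlJones N q (k + 1) = wenzlJones N q (k + 1) ∧
    E N (q + q⁻¹) (N - (k + 1)) * wenzlJones N q (k + 1) * E N (q + q⁻¹) (N - (k + 1)) =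
      (qnum q (k + 2) / qnum q (k + 1)) •
        (E N (q + q⁻¹) (N - (k + 1)) * wenzlJones N q k) := by
  induction k with
  | zero =>
    -- Here `P_0 = P_1 = 1`, and the third identity says `E² = ([2]/[1]) E`, that is `β[1] = [2]`.
    have h1 := h 1 le_rfl le_rfl
    have h2 := qnum_rec q hq 0
    have h0 : qnum q 0 = 0 := by simp [qnum]
    simp only [wenzlJones, mul_one, true_and, E_mul_self]
    congr 1
    rw [eq_div_iff (by simpa using h1)]
    simpa [h0] using h2
  | succ k ih =>
    obtain ⟨i1, i2, i3⟩ := ih (by omega) fun m hm hm' => h m hm (by omega)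
    have hk1 := h (k + 1) (by omega) (by omega)
    have hk2 := h (k + 2) (by omega) (by omega)
    have hrec : wenzlJones N q (k + 1 + 1) = wenzlJones N q (k + 1) -
        (qnum q (k + 1) / qnum q (k + 2)) • (wenzlJones N q (k + 1) *
          E N (q + q⁻¹) (N - (k + 1)) * wenzlJones N q (k + 1)) := by
      rw [wenzlJones, show N - (k + 2) + 1 = N - (k + 1) by omega]
    have hcomm := commute_wenzlJones N q (k + 1) (k + 2) (by omega) hkN
    have hbr := E_braid N (q + q⁻¹) (i := N - (k + 2)) (j := N - (k + 1)) (by omega) (by omega)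
      (by omega)
    have hsq := E_mul_self N (q + q⁻¹) (N - (k + 2))
    rw [show N - (k + 1 + 1) = N - (k + 2) from rfl]
    rw [hrec]
    generalize wenzlJones N q (k + 1) = p' at *
    generalize wenzlJones N q k = p at *
    generalize E N (q + q⁻¹) (N - (k + 1)) = f at *
    generalize E N (q + q⁻¹) (N - (k + 2)) = g at *
    have hc : qnum q (k + 1) / qnum q (k + 2) ≠ 0 := div_ne_zero hk1 hk2
    refine ⟨?_, ?_, ?_⟩
    · exact isIdempotentElem_wenzlJones_step hc i1 i2 (by rw [inv_div]; exact i3)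
    · rw [mul_sub, i1, mul_smul_comm, ← mul_assoc, ← mul_assoc, i1]
    · have e1 : g * p' * g = (q + q⁻¹) • (g * p') := by
        rw [hcomm.eq, mul_assoc, hsq, mul_smul_comm]
      -- Since `g` commutes with `p'`, it can be moved next to `f` on both sides, where `g f g = g`.
      -- The coefficient of `g p'` in the third identity becomes `β - [k+1]/[k+2] = [k+3]/[k+2]`.
      have e2 : g * (p' * f * p') * g = g * p' := by
        calc g * (p' * f * p') * g = g * p' * f * (p' * g) := by noncomm_ring
          _ = p' * (g * f * g) * p' := by
            rw [← hcomm.eq]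
            nth_rw 1 [hcomm.eq]
            simp only [mul_assoc]
          _ = _ := by rw [hbr, ← hcomm.eq, mul_assoc, i1]
      rw [mul_sub, sub_mul, e1, mul_smul_comm, smul_mul_assoc, e2, ← sub_smul]
      congr 1
      have := qnum_rec q hq (k + 1)
      rw [sub_eq_iff_eq_add, ← add_div, eq_div_iff hk2]
      exact this

theorem isIdempotentElem_wenzlJones {n k : ℕ} (hn : 1 ≤ n) (hk : 2 ≤ k) {q : ℂ} (hq : q ≠ 0)
    (hℓ : ∀ ℓ : ℕ, IsLeast {m : ℕ | 0 < m ∧ q ^ (2 * m) = 1} ℓ → k < ℓ) :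
    IsIdempotentElem (wenzlJones (n + k) q k) := by
  have hne : ∀ m, 1 ≤ m → m ≤ k → q ^ (2 * m) ≠ 1 := by
    intro m hm hmk h
    -- If `q` is not a root of unity, this set is empty and `hℓ` is vacuous; a vanishing `[m]` with
    -- `m ≤ k` would make it nonempty with least element at most `k`.
    have hs : {m : ℕ | 0 < m ∧ q ^ (2 * m) = 1}.Nonempty := ⟨m, hm, h⟩
    have h1 := hℓ _ ⟨Nat.sInf_mem hs, fun x hx => Nat.sInf_le hx⟩
    have h2 : sInf {m : ℕ | 0 < m ∧ q ^ (2 * m) = 1} ≤ m := Nat.sInf_le ⟨hm, h⟩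
    omega
  obtain ⟨j, rfl⟩ : ∃ j, k = j + 1 := ⟨k - 1, by omega⟩
  exact (wenzlJones_spec _ hq j (by omega) fun m hm hmk =>
    qnum_ne_zero hq (by simpa using hne 1 le_rfl (by omega)) (hne m hm hmk)).1

end TemperleyLieb

namespace TemperleyLieb

/-! ### Radicals of cellular modules -/

/-- Planarity forces the through links to preserve the order, and `Fin d` has only one order
automorphism. This is why the form takes scalar values: `y^* x` is either a multiple of the identity
or not monic. -/
theorem Diagram.Monic.eq_id {d : ℕ} {c : Diagram d d} (h : c.Monic) : c = Diagram.id d := by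
  choose g hg using h
  have hg' : ∀ j, c.link (Sum.inl (g j)) = Sum.inr j := fun j => by rw [← hg, c.link_link]
  have hmono : StrictMono g := by
    intro j j' hjj
    by_contra hcon
    have hne : g j ≠ g j' := fun e => by
      have := hg' j
      rw [e, hg'] at this
      exact hjj.ne' (Sum.inr_injective this)
    have hlt : g j' < g j := lt_of_le_of_ne (not_lt.1 hcon) hne.symm
    -- Right points occur in reverse order along the boundary, so an inversion of `g` is exactly a
    -- forbidden crossing.
    have := c.planar (Sum.inl (g j')) (Sum.inl (g j))
    rw [hg', hg'] at this
    simp only [pos, Fin.lt_def, Equiv.trans_apply, Equiv.sumCongr_apply, Sum.map_inl, Sum.map_inr,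
      Equiv.refl_apply, Fin.revPerm_apply, finSumFinEquiv_apply_left, finSumFinEquiv_apply_right,
      Fin.val_castAdd, Fin.val_natAdd, Fin.val_rev] at this
    rw [Fin.lt_def] at hjj hlt
    omega
  have hsurj : Function.Surjective g := Finite.injective_iff_surjective.1 hmono.injective
  obtain rfl : g = _root_.id := by
    have h1 : StrictMono.orderIsoOfSurjective g hmono hsurj = OrderIso.refl _ :=
      Subsingleton.elim _ _
    funext j
    exact congrArg (fun f : Fin d ≃o Fin d => f j) h1
  ext (s | s)
  · exact hg' s
  · exact hg s

/-- The element `u y^*` of `TL_n(β)`, for `u` and `y` in `S_n^d`. -/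
noncomputable def rankOne {n d : ℕ} (β : ℂ) (u y : Cell n d) : TL n β :=
  (TL.coeff n β).symm (compLin β n d n (Cell.incl n d u)
    (Finsupp.lmapDomain ℂ ℂ Diagram.reflect (Cell.incl n d y)))

/-- By associativity `(u y^*) x = u (y^* x)`. On diagrams, either `y^* x` is a power of `β` times
the identity, or it is not monic and neither is its composite with `u`. -/
theorem rankOne_smul {n d : ℕ} (β : ℂ) (u y x : Cell n d) :
    rankOne β u y • x = form n d β y x • u := by
  rw [Cell.smul_def, rankOne, LinearEquiv.apply_symm_apply, compLin_assoc]
  induction u using Finsupp.induction_linear with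
  | zero => simp
  | add u u' hu hu' => simp only [map_add, LinearMap.add_apply, hu, hu', smul_add]
  | single u a =>
    induction y using Finsupp.induction_linear with
    | zero => simp
    | add y y' hy hy' => simp only [map_add, LinearMap.add_apply, hy, hy', add_smul]
    | single y b =>
      induction x using Finsupp.induction_linear with
      | zero => simp
      | add x x' hx hx' => simp only [map_add, hx, hx', add_smul]
      | single x c =>
        simp only [Cell.incl_single, Finsupp.lmapDomain_apply, Finsupp.mapDomain_single,
          compLin_single, form_single, pairing]
        split_ifs with hm
        · rw [hm.eq_id, (comp_id_aux u.1).1, (comp_id_aux u.1).2, Cell.proj_monic u.2,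
            Finsupp.smul_single, smul_eq_mul]
          congr 1
          ring
        · rw [Cell.proj_not_monic fun h => hm h.of_comp]
          simp

theorem form_symm {n d : ℕ} (β : ℂ) (v w : Cell n d) : form n d β v w = form n d β w v := by
  induction v using Finsupp.induction_linear with
  | zero => simp
  | add v v' hv hv' => simp only [map_add, LinearMap.add_apply, hv, hv']
  | single v a =>
    induction w using Finsupp.induction_linear with
    | zero => simp
    | add w w' hw hw' => simp only [map_add, LinearMap.add_apply, hw, hw']
    | single w b => rw [form_single, form_single, pairing_symm, mul_comm a b]

/-- A proper submodule that contains every proper submodule is the unique maximal one. -/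
theorem jacobson_eq_of_forall_le {R M : Type*} [Ring R] [AddCommGroup M] [Module R M]
    {S : Submodule R M} (hS : S ≠ ⊤) (h : ∀ T : Submodule R M, T ≠ ⊤ → T ≤ S) :
    Module.jacobson R M = S := by
  have hco : IsCoatom S := ⟨hS, fun T hT => by_contra fun hne => hT.not_ge (h T hne)⟩
  refine le_antisymm (sInf_le hco) (le_sInf fun T hT => ?_)
  rw [(hT.le_iff_eq hS).1 (h T hT.1)]

theorem jacobson_cell {n d : ℕ} {β : ℂ} (h : ∃ x y : Cell n d, form n d β x y ≠ 0) :
    Module.jacobson (TL n β) (Cell n d) = radical n d β := by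
  refine jacobson_eq_of_forall_le ?_ fun T hT x hx => ?_
  · obtain ⟨x, y, hxy⟩ := h
    intro htop
    have : x ∈ radical n d β := htop ▸ Submodule.mem_top
    exact hxy (this y)
  · by_contra hcon
    obtain ⟨y, hy⟩ := not_forall.1 hcon
    -- Some `y` pairs nontrivially with `x`, so a scaled `u y^*` sends `x` to the arbitrary vector
    -- `u`, and `T` is everything.
    refine hT (eq_top_iff.2 fun u _ => ?_)
    have hmem := T.smul_mem ((form n d β y x)⁻¹ • rankOne β u y) hx
    rwa [smul_assoc, rankOne_smul,
      inv_smul_smul₀ (by rwa [form_symm])] at hmem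

/-! ### Submodules and operators under restriction to `eAe`. -/

section Restriction

variable {A : Type*} [Ring A] {e : A} (he : IsIdempotentElem e) {V : Type*} [AddCommGroup V]
  [Module A V]

/-- The element `e a e` serves, as `e` fixes `eV`. It lets the rank-one operators of `TL_N` act on
the restricted modules. -/
theorem Res.exists_corner_smul (a : A) :
    ∃ b : he.Corner, ∀ x : Res he V, Res.incl he V (b • x) = e • a • Res.incl he V x := by
  refine ⟨⟨e * a * e, a, rfl⟩, fun x => (Res.incl_smul he V _ x).trans ?_⟩
  change (e * a * e) • _ = _
  rw [mul_smul, Res.smul_incl, mul_smul]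

/-- A submodule of `eV` that consists of the elements of `eV` which lie in a submodule `W` of `V` is
`eW`. -/
theorem exists_res_equiv (W : Submodule A V) (U : Submodule he.Corner (Res he V))
    (h : ∀ x, x ∈ U ↔ Res.incl he V x ∈ W) :
    ∃ φ : U ≃ₗ[he.Corner] Res he W, ∀ x : U,
      ((Res.incl he W (φ x) : W) : V) = Res.incl he V (x : Res he V) := by
  -- The map keeps the underlying vector of `V`, since `e` fixes the elements of `eV`. Linearity and
  -- bijectivity can then be checked in `V`.
  have key : ∀ x : U, ((Res.incl he W (Res.mk he ⟨Res.incl he V x, (h _).1 x.2⟩) : W) : V) =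
      Res.incl he V x := fun x => by
    rw [Res.incl_mk, Submodule.coe_smul, Res.smul_incl]
  have hinj : ∀ y z : Res he W, ((Res.incl he W y : W) : V) = (Res.incl he W z : W) → y = z :=
    fun y z hyz => Res.incl_injective he W (Subtype.ext hyz)
  let f : U →ₗ[he.Corner] Res he W :=
    { toFun := fun x => Res.mk he ⟨Res.incl he V x, (h _).1 x.2⟩
      map_add' := fun x y => hinj _ _ <| (key (x + y)).trans <|
        (map_add (Res.incl he V) _ _).trans <|
          (congrArg₂ (· + ·) (key x) (key y)).symm.trans
            (congrArg Subtype.val (map_add (Res.incl he W) _ _)).symm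
      map_smul' := fun b x => hinj _ _ <| (key (b • x)).trans <|
        (Res.incl_smul he V b x).trans <|
          (congrArg ((b.1 : A) • ·) (key x).symm).trans
            (congrArg Subtype.val (Res.incl_smul he W b (Res.mk he ⟨_, (h _).1 x.2⟩))).symm }
  refine ⟨LinearEquiv.ofBijective f ⟨fun x y hxy => ?_, fun y => ?_⟩, key⟩
  · apply Subtype.ext
    apply Res.incl_injective
    exact (key x).symm.trans
      ((congrArg (fun z => ((Res.incl he W z : W) : V)) hxy).trans (key y))
  · have hy : Res.incl he V (Res.mk he ((Res.incl he W y : W) : V)) = (Res.incl he W y : W) := by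
      rw [Res.incl_mk, ← Submodule.coe_smul, Res.smul_incl]
    refine ⟨⟨Res.mk he ((Res.incl he W y : W) : V), (h _).2 (by
      rw [hy]; exact (Res.incl he W y).2)⟩,
      hinj _ _ ?_⟩
    exact (key _).trans hy

end Restriction

/-! ### The radicals over the boundary seam algebra. -/

section Seam

variable {n k : ℕ} {q : ℂ} (hP : IsIdempotentElem (wenzlJones (n + k) q k)) {d : ℕ}

theorem jacobson_seamCell (h : ∃ x y : SeamCell hP d, seamForm hP d x y ≠ 0) :
    Module.jacobson (SeamAlgebra hP) (SeamCell hP d) = seamRadical hP d := by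
  refine jacobson_eq_of_forall_le ?_ fun T hT x hx => ?_
  · obtain ⟨x, y, hxy⟩ := h
    intro htop
    have : x ∈ seamRadical hP d := htop ▸ Submodule.mem_top
    exact hxy (this y)
  · by_contra hcon
    obtain ⟨y, hy⟩ := not_forall.1 hcon
    refine hT (eq_top_iff.2 fun u _ => ?_)
    -- Now `u` and `y` lie in `P_k S`. The operator `a` sends `x` to `u`, and the extra `P_k` from
    -- the corner leaves `u` unchanged.
    set a : TL (n + k) (q + q⁻¹) := (seamForm hP d x y)⁻¹ •
      rankOne (q + q⁻¹) (Res.incl hP _ u) (Res.incl hP _ y) with ha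
    obtain ⟨b, hb⟩ := Res.exists_corner_smul hP (V := Cell (n + k) d) a
    have hmem := T.smul_mem b hx
    convert hmem
    apply Res.incl_injective
    rw [hb, ha, smul_assoc, rankOne_smul,
      form_symm, ← seamForm, inv_smul_smul₀ hy, Res.smul_incl]

/-- The adjoint of `P_k` is `P_k` itself, and it fixes `x`; testing `x` against `P_k y` is therefore
the same as testing it against `y`. -/
theorem mem_seamRadical_iff (x : SeamCell hP d) :
    x ∈ seamRadical hP d ↔ Res.incl hP _ x ∈ radical (n + k) d (q + q⁻¹) := by
  refine ⟨fun h y => ?_, fun h y => h _⟩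
  have := h (Res.mk hP y)
  rwa [seamForm, Res.incl_mk, form_symm, form_smul, reflect_wenzlJones, Res.smul_incl,
    form_symm] at this

end Seam

end TemperleyLieb

/-! ### The main theorem. -/

open TemperleyLieb

theorem mainTheorem12 (n k : ℕ) (hn : 1 ≤ n) (hk : 2 ≤ k) (q : ℂ) (hq : q ≠ 0)
    (hℓ : ∀ ℓ : ℕ, IsLeast {m : ℕ | 0 < m ∧ q ^ (2 * m) = 1} ℓ → k < ℓ) :
    ∃ hP : IsIdempotentElem (wenzlJones (n + k) q k),
      (∀ d ∈ Delta n k,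
        ∃ φ : seamRadical hP d ≃ₗ[SeamAlgebra hP] Res hP (radical (n + k) d (q + q⁻¹)),
          ∀ x : seamRadical hP d,
            ((Res.incl hP (radical (n + k) d (q + q⁻¹)) (φ x) : radical (n + k) d (q + q⁻¹)) :
              Cell (n + k) d) = Res.incl hP (Cell (n + k) d) (x : SeamCell hP d)) ∧
      (∀ d ∈ Delta0 hP,
        ∃ ψ : Module.jacobson (SeamAlgebra hP) (Res hP (Cell (n + k) d)) ≃ₗ[SeamAlgebra hP]
            Res hP (Module.jacobson (TL (n + k) (q + q⁻¹)) (Cell (n + k) d)),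
          ∀ x : Module.jacobson (SeamAlgebra hP) (Res hP (Cell (n + k) d)),
            ((Res.incl hP (Module.jacobson (TL (n + k) (q + q⁻¹)) (Cell (n + k) d)) (ψ x) :
              Module.jacobson (TL (n + k) (q + q⁻¹)) (Cell (n + k) d)) : Cell (n + k) d) =
              Res.incl hP (Cell (n + k) d) (x : Res hP (Cell (n + k) d))) := by
  have hP := isIdempotentElem_wenzlJones hn hk hq hℓ
  refine ⟨hP, fun d _ => exists_res_equiv hP _ _ (mem_seamRadical_iff hP), fun d hd => ?_⟩
  obtain ⟨-, x, y, hxy⟩ := hd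
  refine exists_res_equiv hP _ _ ?_
  -- The vectors witnessing a nonzero form on `P_k S` also witness it on `S`, so both Jacobson
  -- radicals are radicals of forms and the criterion of (a) applies.
  rw [jacobson_cell ⟨_, _, hxy⟩]
  have h := jacobson_seamCell hP ⟨x, y, hxy⟩
  rw [h]
  exact mem_seamRadical_iff hP
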